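/- Let $\mathcal H$ be a complex Hilbert space. A (normalized, real) POVM is a map $F$ from the Borel sets $\mathcal B(\mathbb R)$ to the positive bounded operators on $\mathcal H$ with $F(\mathbb R)=\mathbf 1$ and $F(\bigcup_{n}\Delta_n)=\sum_{n}F(\Delta_n)$ in the weak operator topology for every sequence of pairwise disjoint Borel sets $\Delta_n$; it is commutative if $F(\Delta_1)F(\Delta_2)=F(\Delta_2)F(\Delta_1)$ for all Borel $\Delta_1,\Delta_2$. It is uniformly continuous if $\lim_{n\to\infty}\big\|\sum_{i=1}^{n}F(\Delta_i)-F(\bigcup_{i=1}^\infty\Delta_i)\big\|=0$ for every sequence of pairwise disjoint Borel sets $\Delta_i$. A sharp version of $F$ is a bounded self-adjoint operator $A=\int\lambda\,dE_\lambda$, with spectrum contained in $[0,1]$ and spectral measure $E$, such that $A$ and $\{F(\Delta):\Delta\in\mathcal B(\mathbb R)\}$ generate the same von Neumann algebra. A strong Feller Markov kernel is a map $\mu:[0,1]\times\mathcal B(\mathbb R)\to[0,1]$, $(\lambda,\Delta)\mapsto\mu_\Delta(\lambda)$, such that $\mu_{(\cdot)}(\lambda)$ is a probability measure for each $\lambda\in[0,1]$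 and $\mu_\Delta$ is continuous on $[0,1]$ for each $\Delta\in\mathcal B(\mathbb R)$. We say that $F$ admits a strong Feller Markov kernel if there exist a sharp version $A$ of $F$, with spectral measure $E$, and a strong Feller Markov kernel $\mu$ such that $F(\Delta)=\int\mu_\Delta(\lambda)\,dE_\lambda$ for every $\Delta\in\mathcal B(\mathbb R)$. **Theorem.** A commutative POVM $F:\mathcal B(\mathbb R)\to\mathcal B(\mathcal H)$ admits a strong Feller Markov kernel if and only if it is uniformly continuous. -/

import Mathlib

open MeasureTheory ProbabilityTheory Filter Topology

/-- A normalized semispectral measure (positive operator valued measure) on a measurable space `X`,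
acting in the Hilbert space `H`: a map from the measurable sets to the positive bounded operators,
`σ`-additive in the weak operator topology and of total mass `1`.
The values on non-measurable sets carry no meaning and are never used. -/
structure POVM (X : Type*) [MeasurableSpace X] (H : Type*) [NormedAddCommGroup H]
    [InnerProductSpace ℂ H] [CompleteSpace H] where
  /-- the operator attached to a set -/
  op : Set X → (H →L[ℂ] H)
  isPositive : ∀ Δ, MeasurableSet Δ → (op Δ).IsPositive
  weak_sigma_additive : ∀ Δ : ℕ → Set X, (∀ i, MeasurableSet (Δ i)) →
    Pairwise (Function.onFun Disjoint Δ) →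
    ∀ x y : H, HasSum (fun i => inner ℂ x (op (Δ i) y)) (inner ℂ x (op (⋃ i, Δ i) y))
  normalized : op Set.univ = 1

/-- The von Neumann algebra generated by a set `S` of bounded operators: the double commutant of
`S ∪ star S` (`StarSubalgebra.centralizer ℂ S` is the commutant of `S ∪ star S`). -/
noncomputable def vonNeumannGenerated {H : Type*} [NormedAddCommGroup H] [InnerProductSpace ℂ H]
    [CompleteSpace H] (S : Set (H →L[ℂ] H)) : VonNeumannAlgebra H where
  toStarSubalgebra :=
    StarSubalgebra.centralizer ℂ (StarSubalgebra.centralizer ℂ S : Set (H →L[ℂ] H))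
  centralizer_centralizer' := by
    have h : ∀ M : StarSubalgebra ℂ (H →L[ℂ] H),
        (StarSubalgebra.centralizer ℂ (M : Set (H →L[ℂ] H)) : Set (H →L[ℂ] H))
          = Set.centralizer (M : Set (H →L[ℂ] H)) := by
      intro M
      rw [StarSubalgebra.coe_centralizer]
      congr 1
      apply Set.union_eq_left.mpr
      intro a ha
      simpa using star_mem (s := M) (Set.mem_star.mp ha)
    change Set.centralizer (Set.centralizer
      (StarSubalgebra.centralizer ℂ (StarSubalgebra.centralizer ℂ S : Set (H →L[ℂ] H)) :
        Set (H →L[ℂ] H))) = _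
    rw [h]
    exact (Set.centralizer_centralizer_centralizer
      (StarSubalgebra.centralizer ℂ S : Set (H →L[ℂ] H))).trans (h _).symm

/-- The generated von Neumann algebra is the smallest one that contains the set. -/
theorem vonNeumannGenerated_le_iff {H : Type*} [NormedAddCommGroup H] [InnerProductSpace ℂ H]
    [CompleteSpace H] (S : Set (H →L[ℂ] H)) (M : VonNeumannAlgebra H) :
    vonNeumannGenerated S ≤ M ↔ S ⊆ (M : Set (H →L[ℂ] H)) := by
  have hmem : ∀ a, a ∈ vonNeumannGenerated S ↔
      a ∈ StarSubalgebra.centralizer ℂ (StarSubalgebra.centralizer ℂ S : Set (H →L[ℂ] H)) :=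
    fun a => Iff.rfl
  constructor
  · intro h a ha
    refine h ((hmem a).2 ?_)
    rw [StarSubalgebra.mem_centralizer_iff]
    intro g hg
    have hg' := (StarSubalgebra.mem_centralizer_iff ℂ).1 hg a ha
    refine ⟨hg'.1.symm, ?_⟩
    have := congrArg star hg'.2
    simp only [star_mul, star_star] at this
    exact this
  · intro h a ha
    have ha' := (StarSubalgebra.mem_centralizer_iff ℂ).1 ((hmem a).1 ha)
    rw [← VonNeumannAlgebra.commutant_commutant M, VonNeumannAlgebra.mem_commutant_iff]
    intro g hg
    refine (ha' g ?_).1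
    refine (StarSubalgebra.mem_centralizer_iff ℂ).2 fun s hs => ?_
    have h1 := VonNeumannAlgebra.mem_commutant_iff.1 hg
    exact ⟨h1 s (h hs), h1 (star s) (star_mem (h hs))⟩

namespace POVM

variable {X : Type*} [MeasurableSpace X] {H : Type*} [NormedAddCommGroup H]
    [InnerProductSpace ℂ H] [CompleteSpace H]

theorem op_empty_inner (F : POVM X H) (x : H) : inner ℂ x (F.op ∅ x) = 0 := by
  have h := F.weak_sigma_additive (fun _ => ∅) (fun _ => MeasurableSet.empty)
    (fun _ _ _ => by simp [Function.onFun]) x x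
  exact tendsto_nhds_unique tendsto_const_nhds h.summable.tendsto_atTop_zero

/-- The finite positive measure `Δ ↦ ⟨F(Δ) x, x⟩`. -/
noncomputable def scalarMeasure (F : POVM X H) (x : H) : Measure X :=
  Measure.ofMeasurable (fun Δ _ => ENNReal.ofReal (RCLike.re (inner ℂ x (F.op Δ x))))
    (by simp [F.op_empty_inner x])
    (by
      intro Δ hΔ hd
      have h := (F.weak_sigma_additive Δ hΔ hd x x).mapL (RCLike.reCLM (K := ℂ))
      simp only [RCLike.reCLM_apply] at h
      rw [← h.tsum_eq]
      exact ENNReal.ofReal_tsum_of_nonneg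
        (fun i => (F.isPositive _ (hΔ i)).re_inner_nonneg_right x) h.summable)

theorem scalarMeasure_apply (F : POVM X H) (x : H) {Δ : Set X} (hΔ : MeasurableSet Δ) :
    F.scalarMeasure x Δ = ENNReal.ofReal (RCLike.re (inner ℂ x (F.op Δ x))) :=
  Measure.ofMeasurable_apply Δ hΔ

/-- `B = ∫ f dF` for a bounded measurable function `f`, i.e. `⟨B x, x⟩ = ∫ f d⟨F(·) x, x⟩` for
all vectors `x`. -/
def IsIntegral (F : POVM X H) (f : X → ℝ) (B : H →L[ℂ] H) : Prop :=
  ∀ x : H, inner ℂ (B x) x = ((∫ t, f t ∂(F.scalarMeasure x) : ℝ) : ℂ)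

/-- Commutativity: `[F(Δ₁), F(Δ₂)] = 0`. -/
def IsCommutative (F : POVM X H) : Prop :=
  ∀ Δ₁ Δ₂ : Set X, MeasurableSet Δ₁ → MeasurableSet Δ₂ → Commute (F.op Δ₁) (F.op Δ₂)

/-- A spectral measure (PVM) is an orthogonal normalized POVM. -/
def IsPVM (E : POVM X H) : Prop :=
  ∀ Δ₁ Δ₂ : Set X, MeasurableSet Δ₁ → MeasurableSet Δ₂ → Disjoint Δ₁ Δ₂ →
    E.op Δ₁ * E.op Δ₂ = 0

/-- Uniform continuity: `σ`-additivity in the operator norm. -/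
def IsUniformlyContinuous (F : POVM X H) : Prop :=
  ∀ Δ : ℕ → Set X, (∀ i, MeasurableSet (Δ i)) → Pairwise (Function.onFun Disjoint Δ) →
    Tendsto (fun n => ∑ i ∈ Finset.range n, F.op (Δ i)) atTop (𝓝 (F.op (⋃ i, Δ i)))

/-- The von Neumann algebra generated by `F`. -/
noncomputable def vonNeumann (F : POVM X H) : VonNeumannAlgebra H :=
  vonNeumannGenerated {B | ∃ Δ, MeasurableSet Δ ∧ F.op Δ = B}

/-- `A` is a sharp version of `F` with spectral measure `E` living on `[0, 1]`: `A = ∫ λ dE_λ` is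
the bounded self-adjoint operator that corresponds to the spectral measure `E`, and `A` and `F`
generate the same von Neumann algebra. -/
structure IsSharpVersion (F : POVM ℝ H) (A : H →L[ℂ] H) (E : POVM (Set.Icc (0 : ℝ) 1) H) :
    Prop where
  isSelfAdjoint : IsSelfAdjoint A
  isPVM : E.IsPVM
  isIntegral : E.IsIntegral (fun t => (t : ℝ)) A
  generates : vonNeumannGenerated {A} = F.vonNeumann

end POVM

/-- A Markov kernel `μ : [0, 1] × 𝓑(ℝ) → [0, 1]` is strong Feller if `λ ↦ μ_Δ(λ)` is continuous
for every Borel set `Δ`. -/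
def IsStrongFeller (μ : Kernel (Set.Icc (0 : ℝ) 1) ℝ) : Prop :=
  ∀ Δ : Set ℝ, MeasurableSet Δ → Continuous fun t => (μ t).real Δ

/-- `F` admits a strong Feller Markov kernel: `F(Δ) = ∫ μ_Δ(λ) dE_λ` for every Borel set `Δ`, with
a strong Feller Markov kernel `μ` and the spectral measure `E` of a sharp version of `F`. -/
def POVM.AdmitsStrongFellerKernel {H : Type*} [NormedAddCommGroup H] [InnerProductSpace ℂ H]
    [CompleteSpace H] (F : POVM ℝ H) : Prop :=
  ∃ (A : H →L[ℂ] H) (E : POVM (Set.Icc (0 : ℝ) 1) H) (μ : Kernel (Set.Icc (0 : ℝ) 1) ℝ),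
    F.IsSharpVersion A E ∧ IsMarkovKernel μ ∧ IsStrongFeller μ ∧
      ∀ Δ : Set ℝ, MeasurableSet Δ → E.IsIntegral (fun t => (μ t).real Δ) (F.op Δ)

/-! Strong Feller implies uniform continuity by Dini's theorem. For disjoint Borel sets, the kernel
values of the finite unions are continuous on `[0, 1]` and increase to the continuous kernel value
of the full union. The convergence is therefore uniform, and integration against a normalized POVM
does not increase the sup norm (`IsIntegral.norm_le`).

For the converse, the von Neumann algebra of a commutative `F` is commutative, so its self-adjoint
part is an isometric copy `ψ` of some `C(Y, ℝ)`. Write `F(Δ) = ψ(k_Δ)`. Norm additivity of `F` is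
sup-norm additivity of `k`, hence additivity at every point of `Y`. It remains to replace `Y` by
`[0, 1]`.

The spectral projections of `F((-∞, q]]` at rational levels `r` belong to the algebra, so they are
continuous `{0, 1}`-valued functions on `Y` (`exists_spectral_projections`). Being countably many,
they are the digits of one continuous `a : Y → [0, 1]` (`exists_coding`). On a fibre of `a` all
these projections agree. Hence so do the `k_Δ` of rational half-lines, and by a π-λ argument so do
all `k_Δ`.

Each `k_Δ` thus descends to the compact set `a(Y)`. A positive, unital, contractive linear extension
operator from `C(a(Y))` to `C([0, 1])` yields continuous `w_Δ` with `w_Δ ∘ a = k_Δ`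
(`exists_linear_descent`). Linearity and contractivity preserve σ-additivity, so `w` is a strong
Feller kernel. With `A = ψ(a)` one has `F(Δ) = w_Δ(A)`; thus `A` is a sharp version, and its
spectral measure comes from `exists_spectralMeasure`. -/

/-! ### Quadratic forms and weak limits of operators. -/

section Operators

variable {H : Type*} [NormedAddCommGroup H] [InnerProductSpace ℂ H]

theorem inner_self_swap_of_real {T : H →L[ℂ] H} {x : H} {r : ℝ} :
    inner ℂ (T x) x = (r : ℂ) ↔ inner ℂ x (T x) = (r : ℂ) := by
  rw [← inner_conj_symm x (T x)]
  constructor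
  · intro h; rw [h, Complex.conj_ofReal]
  · intro h
    have := congrArg (starRingEnd ℂ) h
    simpa using this

theorem op_ext_of_inner_self {S T : H →L[ℂ] H}
    (h : ∀ x, inner ℂ x (S x) = inner ℂ x (T x)) : S = T := by
  have := (ext_inner_map (S : H →ₗ[ℂ] H) (T : H →ₗ[ℂ] H)).1 fun x => by
    have := congrArg (starRingEnd ℂ) (h x)
    simpa using this
  exact ContinuousLinearMap.coe_injective this

theorem inner_polarization (T : H →L[ℂ] H) (x y : H) :
    inner ℂ x (T y) = (inner ℂ (x + y) (T (x + y)) - inner ℂ (x - y) (T (x - y)) -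
      Complex.I * inner ℂ (x + Complex.I • y) (T (x + Complex.I • y)) +
      Complex.I * inner ℂ (x - Complex.I • y) (T (x - Complex.I • y))) / 4 := by
  simp only [map_add, map_sub, map_smul, inner_add_left, inner_add_right, inner_sub_left,
    inner_sub_right, inner_smul_left, inner_smul_right, Complex.conj_I]
  linear_combination (inner ℂ x (T y)) / 2 * (Complex.I_sq) -
    (inner ℂ y (T x)) / 2 * (Complex.I_sq)

theorem hasSum_inner_of_hasSum_inner_self {ι : Type*} {T : ι → H →L[ℂ] H}
    {S : H →L[ℂ] H} (h : ∀ x, HasSum (fun i => inner ℂ x (T i x)) (inner ℂ x (S x)))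
    (x y : H) : HasSum (fun i => inner ℂ x (T i y)) (inner ℂ x (S y)) := by
  rw [inner_polarization S x y]
  simp_rw [fun i => inner_polarization (T i) x y]
  exact (((((h _).sub (h _)).sub ((h _).mul_left _)).add ((h _).mul_left _)).div_const _)

/-- An operator with a nonnegative quadratic form is positive. -/
theorem isPositive_of_inner_eq {T : H →L[ℂ] H} {q : H → ℝ} (hq : ∀ x, 0 ≤ q x)
    (h : ∀ x, inner ℂ x (T x) = (q x : ℂ)) : T.IsPositive := by
  rw [ContinuousLinearMap.isPositive_iff_complex]
  intro x
  rw [inner_self_swap_of_real.2 (h x)]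
  simpa using hq x

variable [CompleteSpace H]

/-- The form bounds say `0 ≤ T ≤ c`, and for positive elements of a C⋆-algebra `T ≤ c` is equivalent
to `‖T‖ ≤ c`. -/
theorem norm_le_of_inner_eq {T : H →L[ℂ] H} {q : H → ℝ} {c : ℝ} (hc : 0 ≤ c)
    (hq : ∀ x, 0 ≤ q x) (hqc : ∀ x, q x ≤ c * ‖x‖ ^ 2)
    (h : ∀ x, inner ℂ x (T x) = (q x : ℂ)) : ‖T‖ ≤ c := by
  have hT := isPositive_of_inner_eq hq h
  have h0 : 0 ≤ T := (ContinuousLinearMap.nonneg_iff_isPositive T).2 hT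
  rw [CStarAlgebra.norm_le_iff_le_algebraMap T hc h0, ContinuousLinearMap.le_def]
  refine isPositive_of_inner_eq (q := fun x => c * ‖x‖ ^ 2 - q x)
    (fun x => sub_nonneg.2 (hqc x)) fun x => ?_
  have h1 : (algebraMap ℝ (H →L[ℂ] H) c) x = (c : ℂ) • x := by
    simp [Algebra.algebraMap_eq_smul_one]
  rw [sub_apply, inner_sub_right, h x, h1, inner_smul_right,
    inner_self_eq_norm_sq_to_K]
  push_cast
  rfl

/-- A bounded sequence of operators whose quadratic forms converge has a weak limit. -/
theorem exists_weak_limit {T : ℕ → H →L[ℂ] H} {C : ℝ} (hC : ∀ n, ‖T n‖ ≤ C) {q : H → ℂ}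
    (h : ∀ x, Tendsto (fun n => inner ℂ x (T n x)) atTop (𝓝 (q x))) :
    ∃ S : H →L[ℂ] H, ∀ x y, Tendsto (fun n => inner ℂ x (T n y)) atTop (𝓝 (inner ℂ x (S y))) := by
  have hC0 : 0 ≤ C := (norm_nonneg _).trans (hC 0)
  have h1 : ∀ x y, ∃ b, Tendsto (fun n => inner ℂ x (T n y)) atTop (𝓝 b) := by
    intro x y
    simp_rw [fun i => inner_polarization (T i) x y]
    exact ⟨_, (((((h _).sub (h _)).sub ((h _).const_mul _)).add ((h _).const_mul _)).div_const _)⟩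
  choose B hB using h1
  have hBadd : ∀ x x' y, B (x + x') y = B x y + B x' y := fun x x' y =>
    tendsto_nhds_unique (hB _ _) (by simpa only [inner_add_left] using (hB x y).add (hB x' y))
  have hBsmul : ∀ (c : ℂ) x y, B (c • x) y = starRingEnd ℂ c * B x y := fun c x y =>
    tendsto_nhds_unique (hB _ _) (by simpa only [inner_smul_left] using (hB x y).const_mul _)
  have hBadd' : ∀ x y y', B x (y + y') = B x y + B x y' := fun x y y' =>
    tendsto_nhds_unique (hB _ _)
      (by simpa only [map_add, inner_add_right] using (hB x y).add (hB x y'))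
  have hBsmul' : ∀ (c : ℂ) x y, B x (c • y) = c * B x y := fun c x y =>
    tendsto_nhds_unique (hB _ _)
      (by simpa only [map_smul, inner_smul_right] using (hB x y).const_mul _)
  have hbound : ∀ x y, ‖B x y‖ ≤ C * ‖x‖ * ‖y‖ := by
    intro x y
    refine le_of_tendsto (hB x y).norm (Eventually.of_forall fun n => ?_)
    calc ‖inner ℂ x (T n y)‖ ≤ ‖x‖ * ‖T n y‖ := norm_inner_le_norm _ _
      _ ≤ ‖x‖ * (C * ‖y‖) := by
        gcongr
        exact (T n).le_of_opNorm_le (hC n) y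
      _ = _ := by ring
  let L : H →L⋆[ℂ] H →L[ℂ] ℂ := LinearMap.mkContinuous₂
    (LinearMap.mk₂'ₛₗ (starRingEnd ℂ) (RingHom.id ℂ) B hBadd (fun c x y => by simp [hBsmul])
      hBadd' (fun c x y => by simp [hBsmul'])) C hbound
  -- The operator that represents the form acts on the left argument; its adjoint moves it to the
  -- right.
  refine ⟨ContinuousLinearMap.adjoint (InnerProductSpace.continuousLinearMapOfBilin L),
    fun x y => ?_⟩
  rw [ContinuousLinearMap.adjoint_inner_right,
    InnerProductSpace.continuousLinearMapOfBilin_apply]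
  exact hB x y

/-- Commutation with a fixed operator is stable under weak limits. -/
theorem commute_of_weak_limit {T : ℕ → H →L[ℂ] H} {S R : H →L[ℂ] H}
    (h : ∀ x y, Tendsto (fun n => inner ℂ x (T n y)) atTop (𝓝 (inner ℂ x (S y))))
    (hR : ∀ n, Commute R (T n)) : Commute R S := by
  ext y
  refine ext_inner_left ℂ fun x => ?_
  have h1 := h (ContinuousLinearMap.adjoint R x) y
  have h2 := h x (R y)
  refine tendsto_nhds_unique (f := fun n => inner ℂ x (R (T n y))) (l := atTop) ?_ ?_
  · rw [mul_apply_eq_comp]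
    simpa only [ContinuousLinearMap.adjoint_inner_left] using h1
  · have : ∀ n, R (T n y) = T n (R y) := fun n => congrArg (fun A : H →L[ℂ] H => A y) (hR n).eq
    rw [mul_apply_eq_comp]
    simpa only [this] using h2

end Operators

/-! ### Spectral theorem for representations of `C(X, ℝ)`, `X` compact. -/

section SpectralMeasure

open scoped CompactlySupported

variable {H : Type*} [NormedAddCommGroup H] [InnerProductSpace ℂ H]

theorem measureReal_univ_eq_norm_sq {X : Type*} [TopologicalSpace X]
    [MeasurableSpace X] {φ : C(X, ℝ) →ₐ[ℝ] (H →L[ℂ] H)} {μ : H → Measure X}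
    (hμ : ∀ x (f : C(X, ℝ)), inner ℂ x (φ f x) = ((∫ t, f t ∂(μ x) : ℝ) : ℂ)) (x : H) :
    (μ x).real Set.univ = ‖x‖ ^ 2 := by
  have h := hμ x 1
  rw [map_one, one_apply_eq_self, inner_self_eq_norm_sq_to_K] at h
  simp only [ContinuousMap.one_apply, integral_const, smul_eq_mul, mul_one] at h
  refine Complex.ofReal_injective (h.symm.trans ?_)
  push_cast
  rfl

variable [CompleteSpace H]

theorem IsSelfAdjoint.inner_self_real {T : H →L[ℂ] H} (hT : IsSelfAdjoint T) (x : H) :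
    inner ℂ x (T x) = ((RCLike.re (inner ℂ x (T x)) : ℝ) : ℂ) := by
  have := hT.isSymmetric.coe_re_inner_self_apply x
  exact this.symm

variable {X : Type*} [TopologicalSpace X]

/-- With `f = g²` and `φ g` self-adjoint, the form is `‖φ(g) x‖²`. -/
theorem re_inner_nonneg_of_nonneg {φ : C(X, ℝ) →ₐ[ℝ] (H →L[ℂ] H)}
    (hφ : ∀ f, IsSelfAdjoint (φ f)) {f : C(X, ℝ)} (hf : 0 ≤ f) (x : H) :
    0 ≤ RCLike.re (inner ℂ x (φ f x)) := by
  let g : C(X, ℝ) := ⟨fun t => Real.sqrt (f t), by fun_prop⟩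
  have hg : f = g * g := by
    ext t
    exact (Real.mul_self_sqrt (hf t)).symm
  rw [hg, map_mul, mul_apply_eq_comp, ← ContinuousLinearMap.adjoint_inner_left,
    (ContinuousLinearMap.isSelfAdjoint_iff'.1 (hφ g))]
  exact inner_self_nonneg

variable [CompactSpace X] [MeasurableSpace X] [BorelSpace X]

theorem integrable_continuousMap {μ : Measure X} [IsFiniteMeasure μ] (f : C(X, ℝ)) :
    Integrable f μ :=
  (map_continuous f).integrable_of_hasCompactSupport (HasCompactSupport.of_compactSpace f)

theorem measure_ext_of_integral_nonneg [HasOuterApproxClosed X]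
    {μ ν : Measure X} [IsFiniteMeasure μ] [IsFiniteMeasure ν]
    (h : ∀ f : C(X, ℝ), 0 ≤ f → ∫ t, f t ∂μ = ∫ t, f t ∂ν) : μ = ν := by
  refine ext_of_forall_lintegral_eq_of_IsFiniteMeasure fun f => ?_
  let g : C(X, ℝ) := ⟨fun t => (f t : ℝ), by fun_prop⟩
  have hg : 0 ≤ g := fun t => NNReal.coe_nonneg _
  have key : ∀ (ρ : Measure X) [IsFiniteMeasure ρ],
      ∫⁻ t, f t ∂ρ = ENNReal.ofReal (∫ t, g t ∂ρ) := by
    intro ρ _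
    rw [ofReal_integral_eq_lintegral_ofReal (integrable_continuousMap g)
      (Eventually.of_forall hg)]
    simp [g]
  rw [key μ, key ν, h g hg]

variable [T2Space X]

/-- Riesz–Markov–Kakutani applied to the positive functional `f ↦ ⟨x, φ(f) x⟩`. -/
theorem exists_vectorMeasure {φ : C(X, ℝ) →ₐ[ℝ] (H →L[ℂ] H)}
    (hφ : ∀ f, IsSelfAdjoint (φ f)) (x : H) :
    ∃ μ : Measure X, IsFiniteMeasure μ ∧
      ∀ f : C(X, ℝ), inner ℂ x (φ f x) = ((∫ t, f t ∂μ : ℝ) : ℂ) := by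
  let Λ₀ : C_c(X, ℝ) →ₗ[ℝ] ℝ :=
    { toFun := fun f => RCLike.re (inner ℂ x (φ f.toContinuousMap x))
      map_add' := fun f g => by
        have : (f + g).toContinuousMap = f.toContinuousMap + g.toContinuousMap := rfl
        rw [this, map_add, add_apply, inner_add_right, map_add]
      map_smul' := fun c f => by
        have : (c • f).toContinuousMap = c • f.toContinuousMap := rfl
        have h2 : ((c • φ f.toContinuousMap : H →L[ℂ] H)) x = (c : ℂ) • φ f.toContinuousMap x := by
          simp
        rw [this, map_smul, h2, inner_smul_right]
        simp }
  let Λ : C_c(X, ℝ) →ₚ[ℝ] ℝ := PositiveLinearMap.mk₀ Λ₀ fun f hf =>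
    re_inner_nonneg_of_nonneg hφ (f := f.toContinuousMap) (fun t => hf t) x
  refine ⟨RealRMK.rieszMeasure Λ, inferInstance, fun f => ?_⟩
  rw [(hφ f).inner_self_real x]
  congr 1
  exact (RealRMK.integral_rieszMeasure Λ
    (CompactlySupportedContinuousMap.continuousMapEquiv f)).symm

theorem norm_le_one_of_measureReal {φ : C(X, ℝ) →ₐ[ℝ] (H →L[ℂ] H)} {μ : H → Measure X}
    [∀ x, IsFiniteMeasure (μ x)]
    (hμ : ∀ x (f : C(X, ℝ)), inner ℂ x (φ f x) = ((∫ t, f t ∂(μ x) : ℝ) : ℂ))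
    {Δ : Set X} {T : H →L[ℂ] H} (hT : ∀ x, inner ℂ x (T x) = ((μ x).real Δ : ℂ)) : ‖T‖ ≤ 1 :=
  norm_le_of_inner_eq zero_le_one (fun _ => measureReal_nonneg) (fun x => by
    rw [one_mul, ← measureReal_univ_eq_norm_sq hμ]
    exact measureReal_mono (Set.subset_univ _)) hT

variable [HasOuterApproxClosed X]

/-- Every Borel set has a spectral operator, lying in the double commutant of the range. -/
theorem exists_spectral_op {φ : C(X, ℝ) →ₐ[ℝ] (H →L[ℂ] H)} {μ : H → Measure X}
    [∀ x, IsFiniteMeasure (μ x)]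
    (hμ : ∀ x (f : C(X, ℝ)), inner ℂ x (φ f x) = ((∫ t, f t ∂(μ x) : ℝ) : ℂ))
    {Δ : Set X} (hΔ : MeasurableSet Δ) :
    ∃ T : H →L[ℂ] H, (∀ x, inner ℂ x (T x) = ((μ x).real Δ : ℂ)) ∧
      ∀ R, (∀ f, Commute R (φ f)) → Commute R T := by
  have hX : (inferInstance : MeasurableSpace X) = .generateFrom {s | IsClosed s} := by
    rw [← borel_eq_generateFrom_isClosed]; exact BorelSpace.measurable_eq
  -- Closed sets arise as weak limits of `φ` of continuous approximants of the indicator, disjoint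
  -- unions as weak limits of partial sums. Both limits preserve commutation with `R`.
  induction Δ, hΔ using MeasurableSpace.induction_on_inter hX isPiSystem_isClosed with
  | empty => exact ⟨0, by simp, fun R _ => Commute.zero_right R⟩
  | basic K hK =>
    have hK : IsClosed K := hK
    let f : ℕ → C(X, ℝ) := fun n => ⟨fun t => (hK.apprSeq n t : ℝ), by fun_prop⟩
    have hf0 : ∀ n t, 0 ≤ f n t := fun n t => NNReal.coe_nonneg _
    have hf1 : ∀ n t, f n t ≤ 1 := fun n t => by
      exact_mod_cast HasOuterApproxClosed.apprSeq_apply_le_one hK n t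
    have hlim : ∀ x, Tendsto (fun n => ∫ t, f n t ∂(μ x)) atTop (𝓝 ((μ x).real K)) := by
      intro x
      rw [← integral_indicator_one hK.measurableSet]
      refine tendsto_integral_of_dominated_convergence (fun _ => 1)
        (fun n => (map_continuous (f n)).aestronglyMeasurable) (integrable_const _)
        (fun n => Eventually.of_forall fun t => ?_) (Eventually.of_forall fun t => ?_)
      · rw [Real.norm_of_nonneg (hf0 n t)]; exact hf1 n t
      · have h := tendsto_pi_nhds.1 (HasOuterApproxClosed.tendsto_apprSeq hK) t
        have h' := (NNReal.continuous_coe.tendsto _).comp h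
        refine h'.congr' ?_ |>.trans (le_of_eq ?_)
        · exact Eventually.of_forall fun n => rfl
        · by_cases ht : t ∈ K <;> simp [ht]
    have hlim' : ∀ x, Tendsto (fun n => inner ℂ x (φ (f n) x)) atTop
        (𝓝 (((μ x).real K : ℝ) : ℂ)) := fun x => by
      simp_rw [hμ]
      exact (Complex.continuous_ofReal.tendsto _).comp (hlim x)
    obtain ⟨S, hS⟩ := exists_weak_limit (T := fun n => φ (f n)) (C := 1) (fun n => by
      refine norm_le_of_inner_eq (q := fun x => ∫ t, f n t ∂(μ x)) zero_le_one
        (fun x => integral_nonneg (hf0 n)) (fun x => ?_) (fun x => hμ x (f n))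
      rw [one_mul, ← measureReal_univ_eq_norm_sq hμ]
      calc ∫ t, f n t ∂(μ x) ≤ ∫ t, (1 : ℝ) ∂(μ x) :=
            integral_mono (integrable_continuousMap _) (integrable_const _) (hf1 n)
        _ = _ := by simp) hlim'
    exact ⟨S, fun x => tendsto_nhds_unique (hS x x) (hlim' x),
      fun R hR => commute_of_weak_limit hS fun n => hR _⟩
  | compl Δ hΔ ih =>
    obtain ⟨T, hT, hc⟩ := ih
    refine ⟨1 - T, fun x => ?_, fun R hR => (Commute.one_right R).sub_right (hc R hR)⟩
    rw [sub_apply, one_apply_eq_self, inner_sub_right, hT, measureReal_compl hΔ,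
      measureReal_univ_eq_norm_sq hμ, inner_self_eq_norm_sq_to_K]
    push_cast
    rfl
  | iUnion f hd hf ih =>
    choose T hT hc using ih
    have hsum : ∀ n x, inner ℂ x ((∑ i ∈ Finset.range n, T i) x)
        = ((μ x).real (⋃ i ∈ Finset.range n, f i) : ℂ) := by
      intro n x
      rw [sum_apply, inner_sum,
        measureReal_biUnion_finset (fun i _ j _ hij => hd hij) (fun i _ => hf i)]
      push_cast
      exact Finset.sum_congr rfl fun i _ => hT i x
    have hlim : ∀ x, Tendsto (fun n => inner ℂ x ((∑ i ∈ Finset.range n, T i) x)) atTop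
        (𝓝 (((μ x).real (⋃ i, f i) : ℝ) : ℂ)) := by
      intro x
      have h1 : HasSum (fun i => (μ x).real (f i)) ((μ x).real (⋃ i, f i)) := by
        have := measure_iUnion hd hf (μ := μ x)
        rw [measureReal_def, this, ENNReal.tsum_toReal_eq (fun i => measure_ne_top _ _)]
        refine (ENNReal.summable_toReal ?_).hasSum
        rw [← this]
        exact measure_ne_top _ _
      refine ((Complex.continuous_ofReal.tendsto _).comp h1.tendsto_sum_nat).congr fun n => ?_
      rw [sum_apply, inner_sum]
      simp [hT]
    obtain ⟨S, hS⟩ := exists_weak_limit (fun n => norm_le_one_of_measureReal hμ (hsum n)) hlim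
    exact ⟨S, fun x => tendsto_nhds_unique (hS x x) (hlim x),
      fun R hR => commute_of_weak_limit hS fun n =>
        Commute.sum_right _ _ _ fun i _ => hc i R hR⟩

/-- Spectral operators of intersections are products. -/
theorem inner_mul_spectral_op {φ : C(X, ℝ) →ₐ[ℝ] (H →L[ℂ] H)}
    (hφ : ∀ f, IsSelfAdjoint (φ f)) {μ : H → Measure X}
    [∀ x, IsFiniteMeasure (μ x)]
    (hμ : ∀ x (f : C(X, ℝ)), inner ℂ x (φ f x) = ((∫ t, f t ∂(μ x) : ℝ) : ℂ))
    {Δ Δ' : Set X} (hΔ : MeasurableSet Δ) (hΔ' : MeasurableSet Δ') {T T' : H →L[ℂ] H}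
    (hT : ∀ x, inner ℂ x (T x) = ((μ x).real Δ : ℂ))
    (hTc : ∀ R, (∀ f, Commute R (φ f)) → Commute R T)
    (hT' : ∀ x, inner ℂ x (T' x) = ((μ x).real Δ' : ℂ))
    (hTc' : ∀ R, (∀ f, Commute R (φ f)) → Commute R T') (x : H) :
    inner ℂ x ((T' * T) x) = ((μ x).real (Δ' ∩ Δ) : ℂ) := by
  have hφT : ∀ f, Commute (φ f) T := fun f => hTc _ fun g => by
    rw [Commute, SemiconjBy, ← map_mul, ← map_mul, mul_comm]
  have hsa : ∀ {S : H →L[ℂ] H}, IsSelfAdjoint S → ∀ u v, inner ℂ (S u) v = inner ℂ u (S v) :=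
    fun hS => hS.isSymmetric
  -- Moving the vector by `φ f` multiplies its measure by `f²`.
  have h1 : ∀ (f : C(X, ℝ)) (x : H),
      (μ (φ f x)) = (μ x).withDensity (fun t => ENNReal.ofReal (f t * f t)) := by
    intro f x
    have hfin : IsFiniteMeasure ((μ x).withDensity (fun t => ENNReal.ofReal (f t * f t))) :=
      isFiniteMeasure_withDensity_ofReal (integrable_continuousMap (f * f)).2
    refine measure_ext_of_integral_nonneg fun g hg => ?_
    have e1 := hμ (φ f x) g
    have e2 := hμ x (f * f * g)
    rw [hsa (hφ f), ← mul_apply_eq_comp, ← mul_apply_eq_comp, ← map_mul, ← map_mul,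
      show f * g * f = f * f * g by ring, e2] at e1
    rw [integral_withDensity_eq_integral_toReal_smul (by fun_prop) (by simp)]
    refine (Complex.ofReal_injective e1).symm.trans (integral_congr_ae (Eventually.of_forall ?_))
    intro t
    simp [ENNReal.toReal_ofReal (mul_self_nonneg _)]
  have h2 : ∀ (g : C(X, ℝ)), 0 ≤ g → ∀ x, inner ℂ x ((φ g * T) x)
      = ((∫ t in Δ, g t ∂(μ x) : ℝ) : ℂ) := by
    intro g hg x
    let f : C(X, ℝ) := ⟨fun t => Real.sqrt (g t), by fun_prop⟩
    have hf : g = f * f := by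
      ext t
      exact (Real.mul_self_sqrt (hg t)).symm
    have e1 := hT (φ f x)
    rw [hsa (hφ f), ← mul_apply_eq_comp, ← mul_apply_eq_comp, mul_assoc, ← (hφT f).eq,
      ← mul_assoc, ← map_mul, ← hf] at e1
    rw [e1, h1, measureReal_def, withDensity_apply _ hΔ,
      ← ofReal_integral_eq_lintegral_ofReal (f := fun t => f t * f t)
        (integrable_continuousMap (f * f)).integrableOn
        (Eventually.of_forall fun t => mul_self_nonneg _),
      ENNReal.toReal_ofReal (integral_nonneg fun t => mul_self_nonneg _)]
    congr 2
    rw [hf]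
    rfl
  -- `T` is not yet known to be a projection, so its square root is used: `√T` commutes with `φ`,
  -- hence with `T'`, and passing from `x` to `√T x` restricts the measure to `Δ`.
  have hT0 : 0 ≤ T := (ContinuousLinearMap.nonneg_iff_isPositive T).2
    (isPositive_of_inner_eq (fun _ => measureReal_nonneg) hT)
  have hS : IsSelfAdjoint (CFC.sqrt T) := (CFC.sqrt_nonneg T).isSelfAdjoint
  have hSS : CFC.sqrt T * CFC.sqrt T = T := CFC.sqrt_mul_sqrt_self T hT0
  have hSφ : ∀ f, Commute (CFC.sqrt T) (φ f) := fun f => by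
    rw [CFC.sqrt_eq_cfc]
    exact Commute.cfc_nnreal (hφT f).symm _
  have hST' : Commute (CFC.sqrt T) T' := hTc' _ hSφ
  have h3 : μ (CFC.sqrt T x) = (μ x).restrict Δ := by
    refine measure_ext_of_integral_nonneg fun g hg => ?_
    have e1 := hμ (CFC.sqrt T x) g
    rw [hsa hS, ← mul_apply_eq_comp, ← mul_apply_eq_comp, (hSφ g).eq,
      mul_assoc, hSS, h2 g hg x] at e1
    exact (Complex.ofReal_injective e1).symm
  have e1 := hT' (CFC.sqrt T x)
  rw [hsa hS, ← mul_apply_eq_comp, ← mul_apply_eq_comp, hST'.eq, mul_assoc, hSS] at e1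
  rw [e1, h3, measureReal_restrict_apply hΔ']

/-- The spectral measure of a representation of the algebra of real continuous functions. -/
theorem exists_spectralMeasure {φ : C(X, ℝ) →ₐ[ℝ] (H →L[ℂ] H)}
    (hφ : ∀ f, IsSelfAdjoint (φ f)) :
    ∃ E : POVM X H, E.IsPVM ∧ (∀ f : C(X, ℝ), E.IsIntegral f (φ f)) ∧
      ∀ Δ, MeasurableSet Δ → ∀ R, (∀ f, Commute R (φ f)) → Commute R (E.op Δ) := by
  choose μ hfin hμ using exists_vectorMeasure hφ
  have hex := fun (Δ : Set X) (hΔ : MeasurableSet Δ) => exists_spectral_op hμ hΔ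
  classical
  choose! e he hec using hex
  let E : POVM X H :=
    { op := e
      isPositive := fun Δ hΔ => isPositive_of_inner_eq (fun _ => measureReal_nonneg) (he Δ hΔ)
      weak_sigma_additive := fun Δ hΔ hd => hasSum_inner_of_hasSum_inner_self fun x => by
        rw [he _ (MeasurableSet.iUnion hΔ)]
        simp_rw [fun i => he _ (hΔ i) x]
        rw [Complex.hasSum_ofReal]
        have := measure_iUnion hd hΔ (μ := μ x)
        rw [measureReal_def, this, ENNReal.tsum_toReal_eq (fun i => measure_ne_top _ _)]
        refine (ENNReal.summable_toReal ?_).hasSum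
        rw [← this]
        exact measure_ne_top _ _
      normalized := op_ext_of_inner_self fun x => by
        rw [he _ MeasurableSet.univ, measureReal_univ_eq_norm_sq hμ, one_apply_eq_self,
          inner_self_eq_norm_sq_to_K]
        push_cast
        rfl }
  have hE : ∀ x, E.scalarMeasure x = μ x := fun x => by
    ext Δ hΔ
    rw [E.scalarMeasure_apply x hΔ, show E.op Δ = e Δ from rfl, he Δ hΔ]
    simp
  refine ⟨E, fun Δ₁ Δ₂ h₁ h₂ hd => op_ext_of_inner_self fun x => ?_, fun f x => ?_, hec⟩
  · have := inner_mul_spectral_op hφ hμ h₂ h₁ (he _ h₂) (hec _ h₂) (he _ h₁) (hec _ h₁) x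
    rw [hd.inter_eq] at this
    simpa using this
  · rw [hE, inner_self_swap_of_real]
    exact hμ x f

end SpectralMeasure

/-! ### Gelfand duality for self-adjoint parts. -/

section Gelfand

universe u

/-- The self-adjoint part of a commutative C⋆-algebra is an algebra of real continuous functions. -/
theorem CommCStarAlgebra.exists_real_gelfand (A : Type u) [CommCStarAlgebra A] :
    ∃ (Y : Type u) (_ : TopologicalSpace Y) (_ : CompactSpace Y) (ψ : C(Y, ℝ) →+* A),
      (∀ r : ℝ, ψ (algebraMap ℝ C(Y, ℝ) r) = algebraMap ℂ A (r : ℂ)) ∧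
      (∀ f, IsSelfAdjoint (ψ f)) ∧ (∀ f, ‖ψ f‖ = ‖f‖) ∧
      ∀ b : A, IsSelfAdjoint b → ∃ f, ψ f = b := by
  let G := gelfandStarTransform A
  have hG : ∀ g, ‖G.symm g‖ = ‖g‖ := fun g => by
    have h := (gelfandTransform_isometry A).norm_map_of_map_zero (map_zero _) (G.symm g)
    rw [← h]
    exact congrArg norm (G.apply_symm_apply g)
  let ι : C(WeakDual.characterSpace ℂ A, ℝ) →ₐ[ℝ] C(WeakDual.characterSpace ℂ A, ℂ) :=
    AlgHom.compLeftContinuous ℝ Complex.ofRealAm Complex.continuous_ofReal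
  have hι : ∀ f t, ι f t = (f t : ℂ) := fun f t => rfl
  have hιstar : ∀ f, star (ι f) = ι f := fun f => by
    ext t
    simp [hι]
  have hιnorm : ∀ f, ‖ι f‖ = ‖f‖ := fun f => by
    simp_rw [ContinuousMap.norm_eq_iSup_norm, hι]
    simp
  let ψ : C(WeakDual.characterSpace ℂ A, ℝ) →+* A := 
    (G.symm : C(WeakDual.characterSpace ℂ A, ℂ) →+* A).comp ι.toRingHom
  have hψ : ∀ f, ψ f = G.symm (ι f) := fun f => rfl
  refine ⟨_, inferInstance, inferInstance, ψ, fun r => ?_, fun f => ?_, fun f => ?_,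
    fun b hb => ?_⟩
  · have h1 : ι (algebraMap ℝ _ r) = algebraMap ℂ _ (r : ℂ) := by
      ext t
      rfl
    rw [hψ, h1]
    exact AlgHomClass.commutes G.symm _
  · rw [hψ, IsSelfAdjoint, ← map_star, hιstar]
  · rw [hψ, hG, hιnorm]
  · have hGb : star (G b) = G b := by rw [← map_star, hb.star_eq]
    refine ⟨⟨fun t => (G b t).re, by fun_prop⟩, ?_⟩
    have : ι ⟨fun t => (G b t).re, by fun_prop⟩ = G b := by
      ext t
      exact Complex.conj_eq_iff_re.1 (congrArg (fun g : C(_, ℂ) => g t) hGb)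
    rw [hψ, this]
    exact G.symm_apply_apply b

variable {H : Type u} [NormedAddCommGroup H] [InnerProductSpace ℂ H] [CompleteSpace H]

/-- The self-adjoint part of a closed commutative algebra of operators is an algebra of real
continuous functions. -/
theorem StarSubalgebra.exists_real_gelfand (D : StarSubalgebra ℂ (H →L[ℂ] H))
    (hD : IsClosed (D : Set (H →L[ℂ] H))) (hcomm : ∀ a ∈ D, ∀ b ∈ D, a * b = b * a) :
    ∃ (Y : Type u) (_ : TopologicalSpace Y) (_ : CompactSpace Y)
      (ψ : C(Y, ℝ) →ₐ[ℝ] (H →L[ℂ] H)),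
      (∀ f, IsSelfAdjoint (ψ f)) ∧ (∀ f, ‖ψ f‖ = ‖f‖) ∧ (∀ f, ψ f ∈ D) ∧
      ∀ B ∈ D, IsSelfAdjoint B → ∃ f, ψ f = B := by
  let _ : CommCStarAlgebra D :=
    { StarSubalgebra.cstarAlgebra D (h_closed := hD) with
      mul_comm := fun a b => Subtype.ext (hcomm a a.2 b b.2) }
  obtain ⟨Y, _, _, ψ, hr, hs, hn, hsurj⟩ := CommCStarAlgebra.exists_real_gelfand D
  refine ⟨Y, inferInstance, inferInstance,
    { toRingHom := (D.subtype : D →+* (H →L[ℂ] H)).comp ψ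
      commutes' := fun r => ?_ }, fun f => ?_, fun f => ?_, fun f => (ψ f).2, fun B hB hBs => ?_⟩
  · change ((ψ (algebraMap ℝ C(Y, ℝ) r) : D) : H →L[ℂ] H) = _
    rw [hr r]
    ext x
    change (algebraMap ℂ (H →L[ℂ] H) (r : ℂ)) x = _
    simp [Algebra.algebraMap_eq_smul_one]
  · exact congrArg Subtype.val (hs f)
  · exact hn f
  · obtain ⟨f, hf⟩ := hsurj ⟨B, hB⟩ (Subtype.ext hBs)
    exact ⟨f, congrArg Subtype.val hf⟩

end Gelfand

/-! ### A Dugundji-type extension operator. -/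

section Extension

/-- Weights of the averages in the extension operator. -/
noncomputable def extWeight {X : Type*} [MetricSpace X] (s : Set X) (a : ℕ → X) (i : ℕ) (x : X) :
    ℝ :=
  (1 / 2) ^ i * max 0 (2 * Metric.infDist x s - dist x (a i))

variable {X : Type*} [MetricSpace X] {s : Set X} {a : ℕ → X}

theorem extWeight_nonneg (i : ℕ) (x : X) : 0 ≤ extWeight s a i x := by
  unfold extWeight; positivity

theorem continuous_extWeight (i : ℕ) : Continuous (extWeight s a i) := by
  unfold extWeight
  have := Metric.continuous_infDist_pt s
  fun_prop

open Classical in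
/-- The value at `x` of the extension of a function from `s` to the whole space. -/
noncomputable def extValue (s : Set X) (a : ℕ → X) (ha : ∀ i, a i ∈ s) (f : s → ℝ) (x : X) : ℝ :=
  if h : x ∈ s then f ⟨x, h⟩
  else (∑' i, extWeight s a i x * f ⟨a i, ha i⟩) / ∑' i, extWeight s a i x

theorem extValue_of_mem (ha : ∀ i, a i ∈ s) (f : s → ℝ) (x : s) : extValue s a ha f x = f x := by
  simp [extValue]

variable [CompactSpace X]

theorem extWeight_le (ha : ∀ i, a i ∈ s) (i : ℕ) (x : X) :
    extWeight s a i x ≤ (1 / 2) ^ i * (2 * Metric.diam (Set.univ : Set X)) := by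
  unfold extWeight
  gcongr
  have h1 : Metric.infDist x s ≤ dist x (a i) := Metric.infDist_le_dist_of_mem (ha i)
  have h2 : dist x (a i) ≤ Metric.diam (Set.univ : Set X) :=
    Metric.dist_le_diam_of_mem isCompact_univ.isBounded (Set.mem_univ _) (Set.mem_univ _)
  have h3 : 0 ≤ dist x (a i) := dist_nonneg
  exact max_le (by linarith) (by linarith)

theorem summable_extWeight_mul (ha : ∀ i, a i ∈ s) {g : ℕ → ℝ} {C : ℝ} (hg : ∀ i, |g i| ≤ C)
    (x : X) : Summable fun i => extWeight s a i x * g i := by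
  refine Summable.of_norm_bounded (g := fun i => (1 / 2) ^ i *
    (2 * Metric.diam (Set.univ : Set X)) * C)
    ((summable_geometric_two.mul_right _).mul_right _) fun i => ?_
  rw [norm_mul, Real.norm_of_nonneg (extWeight_nonneg i x)]
  have := Metric.diam_nonneg (s := (Set.univ : Set X))
  exact mul_le_mul (extWeight_le ha i x) (hg i) (abs_nonneg _) (by positivity)

theorem summable_extWeight (ha : ∀ i, a i ∈ s) (x : X) : Summable fun i => extWeight s a i x := by
  simpa using summable_extWeight_mul ha (g := fun _ => 1) (C := 1) (by simp) x

theorem continuous_tsum_extWeight_mul (ha : ∀ i, a i ∈ s) {g : ℕ → ℝ} {C : ℝ}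
    (hg : ∀ i, |g i| ≤ C) : Continuous fun x => ∑' i, extWeight s a i x * g i := by
  refine continuous_tsum (u := fun i => (1 / 2) ^ i * (2 * Metric.diam (Set.univ : Set X)) * C)
    (fun i => (continuous_extWeight i).mul continuous_const)
    ((summable_geometric_two.mul_right _).mul_right _) fun i x => ?_
  rw [norm_mul, Real.norm_of_nonneg (extWeight_nonneg i x)]
  have := Metric.diam_nonneg (s := (Set.univ : Set X))
  exact mul_le_mul (extWeight_le ha i x) (hg i) (abs_nonneg _) (by positivity)

/-- Some point of `s` is closer to `x` than twice the distance to `s`, and by density so is some `a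
i`. This makes the denominator of `extValue` nonzero. -/
theorem tsum_extWeight_pos (hs : IsClosed s) (ha : ∀ i, a i ∈ s) (hd : s ⊆ closure (Set.range a))
    {x : X} (hx : x ∉ s) : 0 < ∑' i, extWeight s a i x := by
  have hne : s.Nonempty := ⟨a 0, ha 0⟩
  have hpos : 0 < Metric.infDist x s := (hs.notMem_iff_infDist_pos hne).1 hx
  obtain ⟨y, hy, hxy⟩ := (Metric.infDist_lt_iff hne (r := 2 * Metric.infDist x s)).1 (by linarith)
  obtain ⟨_, ⟨i, rfl⟩, hi⟩ := Metric.mem_closure_iff.1 (hd hy)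
    (2 * Metric.infDist x s - dist x y) (by linarith)
  refine (summable_extWeight ha x).tsum_pos (fun i => extWeight_nonneg i x) i ?_
  unfold extWeight
  have : 0 < 2 * Metric.infDist x s - dist x (a i) := by
    have := dist_triangle x y (a i)
    linarith
  rw [max_eq_right this.le]
  positivity

/-- The extension at `x` stays in every interval that contains the values of `f` close to `x`. -/
theorem abs_extValue_sub_le (ha : ∀ i, a i ∈ s) (hs : IsClosed s)
    (hd : s ⊆ closure (Set.range a)) {f : s → ℝ} {C : ℝ}
    (hf : ∀ y, |f y| ≤ C) {x : X} {c ε : ℝ}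
    (h : ∀ y : s, dist x y ≤ 2 * Metric.infDist x s → |f y - c| ≤ ε) :
    |extValue s a ha f x - c| ≤ ε := by
  by_cases hx : x ∈ s
  · rw [extValue_of_mem ha f ⟨x, hx⟩]
    exact h ⟨x, hx⟩ (by simp [Metric.infDist_nonneg])
  have hpos := tsum_extWeight_pos hs ha hd hx
  have hsum := summable_extWeight ha x
  have hsf := summable_extWeight_mul ha (fun i => hf ⟨a i, ha i⟩) x
  have e1 : extValue s a ha f x - c =
      (∑' i, extWeight s a i x * (f ⟨a i, ha i⟩ - c)) / ∑' i, extWeight s a i x := by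
    rw [extValue, dif_neg hx, eq_div_iff hpos.ne', sub_mul, div_mul_cancel₀ _ hpos.ne',
      ← tsum_mul_left, ← hsf.tsum_sub (hsum.mul_left c)]
    exact tsum_congr fun i => by ring
  rw [e1, abs_div, abs_of_pos hpos, div_le_iff₀ hpos, ← tsum_mul_left]
  rw [← Real.norm_eq_abs]
  refine tsum_of_norm_bounded (hsum.mul_left ε).hasSum fun i => ?_
  rw [norm_mul, Real.norm_of_nonneg (extWeight_nonneg i x), mul_comm ε]
  rcases le_or_gt (dist x (a i)) (2 * Metric.infDist x s) with h1 | h1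
  · exact mul_le_mul_of_nonneg_left (h ⟨a i, ha i⟩ h1) (extWeight_nonneg i x)
  · have : extWeight s a i x = 0 := by
      unfold extWeight
      rw [max_eq_left (by linarith), mul_zero]
    simp [this]

theorem continuous_extValue (ha : ∀ i, a i ∈ s) (hs : IsClosed s)
    (hd : s ⊆ closure (Set.range a)) {f : s → ℝ}
    (hf : Continuous f) : Continuous (extValue s a ha f) := by
  have : CompactSpace s := isCompact_iff_compactSpace.1 hs.isCompact
  obtain ⟨C, hC⟩ : ∃ C, ∀ y, |f y| ≤ C := ⟨‖(⟨f, hf⟩ : C(s, ℝ))‖, fun y =>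
    ContinuousMap.norm_coe_le_norm ⟨f, hf⟩ y⟩
  rw [continuous_iff_continuousAt]
  intro x
  by_cases hx : x ∈ s
  · rw [Metric.continuousAt_iff]
    intro ε hε
    obtain ⟨δ, hδ, h⟩ := Metric.continuousAt_iff.1 (hf.continuousAt (x := ⟨x, hx⟩)) (ε / 2)
      (half_pos hε)
    -- Relevant points `y` satisfy `dist z y ≤ 2 infDist z s ≤ 2 dist z x`, so `dist y x ≤ 3 dist z
    -- x < δ`.
    refine ⟨δ / 3, by positivity, fun {z} hz => ?_⟩
    rw [Real.dist_eq, extValue_of_mem ha f ⟨x, hx⟩]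
    refine (abs_extValue_sub_le ha hs hd hC fun y hy => ?_).trans_lt (half_lt_self hε)
    have h1 : Metric.infDist z s ≤ dist z x := Metric.infDist_le_dist_of_mem hx
    have h2 := dist_triangle (y : X) z x
    rw [dist_comm (y : X) z] at h2
    have h3 : dist y (⟨x, hx⟩ : s) < δ := by
      change dist (y : X) x < δ
      linarith
    exact (h h3).le
  · have h1 : ContinuousAt (fun x => (∑' i, extWeight s a i x * f ⟨a i, ha i⟩) /
        ∑' i, extWeight s a i x) x := by
      refine ContinuousAt.div (continuous_tsum_extWeight_mul ha fun i => hC _).continuousAt ?_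
        (tsum_extWeight_pos hs ha hd hx).ne'
      simpa using (continuous_tsum_extWeight_mul ha (g := fun _ => 1) (C := 1)
        (by simp)).continuousAt
    refine h1.congr ?_
    filter_upwards [hs.isOpen_compl.mem_nhds hx] with z hz
    rw [extValue, dif_neg hz]

/-- A positive unital linear extension operator from a closed subset of a compact metric space. -/
theorem exists_linear_extension {X : Type*} [MetricSpace X] [CompactSpace X] {s : Set X}
    [CompactSpace s] (hs : IsClosed s) (hne : s.Nonempty) :
    ∃ T : C(s, ℝ) →ₗ[ℝ] C(X, ℝ), (∀ f (x : s), T f x = f x) ∧ T 1 = 1 ∧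
      (∀ f, 0 ≤ f → 0 ≤ T f) ∧ ∀ f, ‖T f‖ ≤ ‖f‖ := by
  have : Nonempty s := hne.to_subtype
  let a' : ℕ → s := TopologicalSpace.denseSeq s
  let a : ℕ → X := fun i => a' i
  have ha : ∀ i, a i ∈ s := fun i => (a' i).2
  have hd : s ⊆ closure (Set.range a) := by
    have h1 := TopologicalSpace.denseRange_denseSeq s
    intro x hx
    have h2 := image_closure_subset_closure_image (continuous_subtype_val (p := (· ∈ s)))
      (s := Set.range a') ⟨⟨x, hx⟩, h1 _, rfl⟩
    rwa [← Set.range_comp] at h2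
  have hb : ∀ (f : C(s, ℝ)) y, |f y| ≤ ‖f‖ := fun f y => ContinuousMap.norm_coe_le_norm f y
  refine ⟨{ toFun := fun f => ⟨extValue s a ha f, continuous_extValue ha hs hd (map_continuous f)⟩
            map_add' := fun f g => ?_
            map_smul' := fun c f => ?_ }, fun f x => extValue_of_mem ha f x, ?_, fun f hf x => ?_,
    fun f => ?_⟩
  · ext x
    simp only [ContinuousMap.coe_mk, ContinuousMap.add_apply]
    unfold extValue
    split_ifs with hx
    · rfl
    · rw [← add_div, ← (summable_extWeight_mul ha (fun i => hb f ⟨a i, ha i⟩) x).tsum_add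
        (summable_extWeight_mul ha (fun i => hb g ⟨a i, ha i⟩) x)]
      congr 1
      exact tsum_congr fun i => by simp [mul_add]
  · ext x
    simp only [ContinuousMap.coe_mk, ContinuousMap.smul_apply, RingHom.id_apply, smul_eq_mul]
    unfold extValue
    split_ifs with hx
    · rfl
    · rw [← mul_div_assoc, ← tsum_mul_left]
      congr 1
      exact tsum_congr fun i => by simp; ring
  · ext x
    have := abs_extValue_sub_le (x := x) ha hs hd (f := (1 : C(s, ℝ))) (C := 1) (by simp)
      (c := 1) (ε := 0) (by simp)
    exact sub_eq_zero.1 (abs_nonpos_iff.1 this)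
  · change 0 ≤ extValue s a ha f x
    unfold extValue
    split_ifs with hx
    · exact hf _
    · exact div_nonneg (tsum_nonneg fun i => mul_nonneg (extWeight_nonneg i x) (hf _))
        (tsum_nonneg fun i => extWeight_nonneg i x)
  · rw [ContinuousMap.norm_le _ (norm_nonneg f)]
    intro x
    have := abs_extValue_sub_le ha hs hd (hb f) (x := x) (c := 0) (ε := ‖f‖)
      (by simpa using fun y hy _ => hb f ⟨y, hy⟩)
    simpa using this

end Extension

/-! ### Integration against a POVM; strong Feller implies uniform continuity. -/

namespace POVM

variable {X : Type*} [MeasurableSpace X] {H : Type*} [NormedAddCommGroup H]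
    [InnerProductSpace ℂ H] [CompleteSpace H]

instance isFiniteMeasure_scalarMeasure (F : POVM X H) (x : H) :
    IsFiniteMeasure (F.scalarMeasure x) :=
  ⟨by rw [F.scalarMeasure_apply x MeasurableSet.univ]; exact ENNReal.ofReal_lt_top⟩

theorem inner_op_self (F : POVM X H) (x : H) {Δ : Set X} (hΔ : MeasurableSet Δ) :
    inner ℂ x (F.op Δ x) = ((F.scalarMeasure x).real Δ : ℂ) := by
  rw [measureReal_def, F.scalarMeasure_apply x hΔ,
    ENNReal.toReal_ofReal ((F.isPositive Δ hΔ).re_inner_nonneg_right x)]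
  exact (F.isPositive Δ hΔ).isSelfAdjoint.inner_self_real x

theorem scalarMeasure_real_univ (F : POVM X H) (x : H) :
    (F.scalarMeasure x).real Set.univ = ‖x‖ ^ 2 := by
  have h := F.inner_op_self x MeasurableSet.univ
  rw [F.normalized, one_apply_eq_self, inner_self_eq_norm_sq_to_K] at h
  refine Complex.ofReal_injective (h.symm.trans ?_)
  push_cast
  rfl

theorem op_empty (F : POVM X H) : F.op ∅ = 0 :=
  op_ext_of_inner_self fun x => by rw [F.inner_op_self x MeasurableSet.empty]; simp

theorem op_compl (F : POVM X H) {Δ : Set X} (hΔ : MeasurableSet Δ) : F.op Δᶜ = 1 - F.op Δ := by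
  refine op_ext_of_inner_self fun x => ?_
  rw [F.inner_op_self x hΔ.compl, measureReal_compl hΔ, sub_apply, inner_sub_right,
    F.inner_op_self x hΔ, ← F.normalized, F.inner_op_self x MeasurableSet.univ]
  push_cast
  rfl

theorem op_biUnion_range (F : POVM X H) {Δ : ℕ → Set X} (hΔ : ∀ i, MeasurableSet (Δ i))
    (hd : Pairwise (Function.onFun Disjoint Δ)) (n : ℕ) :
    F.op (⋃ i ∈ Finset.range n, Δ i) = ∑ i ∈ Finset.range n, F.op (Δ i) := by
  refine op_ext_of_inner_self fun x => ?_
  rw [F.inner_op_self x (Finset.measurableSet_biUnion _ fun i _ => hΔ i),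
    measureReal_biUnion_finset (fun i _ j _ hij => hd hij) (fun i _ => hΔ i), sum_apply, inner_sum]
  push_cast
  exact Finset.sum_congr rfl fun i _ => (F.inner_op_self x (hΔ i)).symm

theorem norm_op_le_one (F : POVM X H) {Δ : Set X} (hΔ : MeasurableSet Δ) : ‖F.op Δ‖ ≤ 1 :=
  norm_le_of_inner_eq zero_le_one (fun _ => measureReal_nonneg) (fun x => by
    rw [one_mul, ← F.scalarMeasure_real_univ]
    exact measureReal_mono (Set.subset_univ _)) fun x => F.inner_op_self x hΔ

theorem IsIntegral.sub {F : POVM X H} {f g : X → ℝ} {A B : H →L[ℂ] H} (hA : F.IsIntegral f A)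
    (hB : F.IsIntegral g B) (hf : ∀ x, Integrable f (F.scalarMeasure x))
    (hg : ∀ x, Integrable g (F.scalarMeasure x)) : F.IsIntegral (fun t => f t - g t) (A - B) := by
  intro x
  rw [sub_apply, inner_sub_left, hA x, hB x, integral_sub (hf x) (hg x)]
  push_cast
  rfl

theorem IsIntegral.norm_le {F : POVM X H} {f : X → ℝ} {A : H →L[ℂ] H} (hA : F.IsIntegral f A)
    (hf : ∀ x, Integrable f (F.scalarMeasure x)) {c : ℝ} (hc : 0 ≤ c) (h0 : ∀ t, 0 ≤ f t)
    (hfc : ∀ t, f t ≤ c) : ‖A‖ ≤ c := by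
  refine norm_le_of_inner_eq hc (fun x => integral_nonneg h0) (fun x => ?_)
    fun x => inner_self_swap_of_real.1 (hA x)
  calc ∫ t, f t ∂(F.scalarMeasure x) ≤ ∫ t, c ∂(F.scalarMeasure x) :=
        integral_mono (hf x) (integrable_const _) hfc
    _ = c * ‖x‖ ^ 2 := by
        rw [integral_const, F.scalarMeasure_real_univ, smul_eq_mul, mul_comm]

/-- A POVM with a strong Feller kernel is `σ`-additive in the operator norm. -/
theorem AdmitsStrongFellerKernel.isUniformlyContinuous {F : POVM ℝ H}
    (h : F.AdmitsStrongFellerKernel) : F.IsUniformlyContinuous := by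
  obtain ⟨A, E, μ, -, hμ, hcont, hint⟩ := h
  intro Δ hΔ hd
  simp_rw [← F.op_biUnion_range hΔ hd]
  have hm : ∀ n, MeasurableSet (⋃ i ∈ Finset.range n, Δ i) := fun n =>
    Finset.measurableSet_biUnion _ fun i _ => hΔ i
  have hmono : Monotone fun n => ⋃ i ∈ Finset.range n, Δ i := fun m n hmn =>
    Set.biUnion_subset_biUnion_left fun i hi => by
      simp only [Finset.coe_range, Set.mem_Iio] at hi ⊢
      exact lt_of_lt_of_le hi hmn
  have hU : ⋃ n, ⋃ i ∈ Finset.range n, Δ i = ⋃ i, Δ i := by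
    ext t
    simp only [Set.mem_iUnion, Finset.mem_range]
    exact ⟨fun ⟨n, i, _, h⟩ => ⟨i, h⟩, fun ⟨i, h⟩ => ⟨i + 1, i, Nat.lt_succ_self i, h⟩⟩
  have hlim : ∀ t, Tendsto (fun n => (μ t).real (⋃ i ∈ Finset.range n, Δ i)) atTop
      (𝓝 ((μ t).real (⋃ i, Δ i))) := fun t => by
    have := tendsto_measure_iUnion_atTop (μ := μ t) hmono
    rw [hU] at this
    exact (ENNReal.tendsto_toReal (measure_ne_top _ _)).comp this
  have hmR : ∀ t, Monotone fun n => (μ t).real (⋃ i ∈ Finset.range n, Δ i) := fun t m n hmn =>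
    measureReal_mono (hmono hmn) (measure_ne_top _ _)
  -- Dini's theorem on the compact interval; continuity of the limit is the strong Feller property
  -- for the full union.
  have hunif := Monotone.tendstoUniformly_of_forall_tendsto (fun n => hcont _ (hm n))
    (fun m n hmn t => hmR t hmn) (hcont _ (MeasurableSet.iUnion hΔ)) hlim
  have hI : ∀ {D : Set ℝ}, MeasurableSet D → ∀ x,
      Integrable (fun t => (μ t).real D) (E.scalarMeasure x) := fun hD x =>
    integrable_continuousMap ⟨_, hcont _ hD⟩
  rw [Metric.tendsto_atTop]
  intro ε hε
  rw [Metric.tendstoUniformly_iff] at hunif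
  obtain ⟨N, hN⟩ := eventually_atTop.1 (hunif (ε / 2) (half_pos hε))
  refine ⟨N, fun n hn => ?_⟩
  rw [dist_comm, dist_eq_norm]
  refine lt_of_le_of_lt (((hint _ (MeasurableSet.iUnion hΔ)).sub (hint _ (hm n))
    (hI (MeasurableSet.iUnion hΔ)) (hI (hm n))).norm_le (c := ε / 2)
    (fun x => (hI (MeasurableSet.iUnion hΔ) x).sub (hI (hm n) x)) (half_pos hε).le
    (fun t => ?_) fun t => ?_) (half_lt_self hε)
  · exact sub_nonneg.2 ((hmR t).ge_of_tendsto (hlim t) n)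
  · exact (le_abs_self _).trans (hN n hn t).le

end POVM

/-! ### Generated von Neumann algebras as double commutants. -/

section Bicommutant

variable {H : Type*} [NormedAddCommGroup H] [InnerProductSpace ℂ H] [CompleteSpace H]

theorem mem_vonNeumannGenerated_iff {S : Set (H →L[ℂ] H)} (hS : ∀ s ∈ S, IsSelfAdjoint s)
    {a : H →L[ℂ] H} :
    a ∈ vonNeumannGenerated S ↔ ∀ R, (∀ s ∈ S, Commute R s) → Commute R a := by
  have hmem : a ∈ vonNeumannGenerated S ↔
      a ∈ StarSubalgebra.centralizer ℂ (StarSubalgebra.centralizer ℂ S : Set (H →L[ℂ] H)) :=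
    Iff.rfl
  have hcen : ∀ R, R ∈ StarSubalgebra.centralizer ℂ S ↔ ∀ s ∈ S, Commute R s := fun R => by
    rw [StarSubalgebra.mem_centralizer_iff]
    refine ⟨fun h s hs => (h s hs).1.symm, fun h s hs => ?_⟩
    rw [(hS s hs).star_eq]
    exact ⟨(h s hs).eq.symm, (h s hs).eq.symm⟩
  rw [hmem, StarSubalgebra.mem_centralizer_iff]
  refine ⟨fun h R hR => (h R ((hcen R).2 hR)).1, fun h R hR => ?_⟩
  exact ⟨h R ((hcen R).1 hR), h (star R) ((hcen _).1 (star_mem hR))⟩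

theorem isClosed_vonNeumannGenerated (S : Set (H →L[ℂ] H)) :
    IsClosed ((vonNeumannGenerated S).toStarSubalgebra : Set (H →L[ℂ] H)) := by
  change IsClosed ((StarSubalgebra.centralizer ℂ
    (StarSubalgebra.centralizer ℂ S : Set (H →L[ℂ] H)) : Set (H →L[ℂ] H)))
  rw [StarSubalgebra.coe_centralizer]
  exact Set.isClosed_centralizer _

/-- Each generator lies in the commutant of `S`, so it commutes with `a`; thus `a` is itself in the
commutant of `S` and commutes with `b`. -/
theorem mul_comm_of_mem_vonNeumannGenerated {S : Set (H →L[ℂ] H)}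
    (hS : ∀ s ∈ S, IsSelfAdjoint s) (hc : ∀ s ∈ S, ∀ t ∈ S, Commute s t) {a b : H →L[ℂ] H}
    (ha : a ∈ vonNeumannGenerated S) (hb : b ∈ vonNeumannGenerated S) : a * b = b * a := by
  rw [mem_vonNeumannGenerated_iff hS] at ha hb
  refine (hb a fun s hs => ?_).eq
  exact (ha s fun t ht => hc s hs t ht).symm

namespace POVM

variable {X : Type*} [MeasurableSpace X]

theorem mem_vonNeumann_iff (F : POVM X H) {a : H →L[ℂ] H} :
    a ∈ F.vonNeumann ↔
      ∀ R, (∀ Δ, MeasurableSet Δ → Commute R (F.op Δ)) → Commute R a := by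
  rw [vonNeumann, mem_vonNeumannGenerated_iff]
  · refine forall_congr' fun R => imp_congr_left ⟨fun h Δ hΔ => h _ ⟨Δ, hΔ, rfl⟩, ?_⟩
    rintro h _ ⟨Δ, hΔ, rfl⟩
    exact h Δ hΔ
  · rintro _ ⟨Δ, hΔ, rfl⟩
    exact (F.isPositive Δ hΔ).isSelfAdjoint

theorem IsPVM.op_mul_self {E : POVM X H} (hE : E.IsPVM) {Δ : Set X} (hΔ : MeasurableSet Δ) :
    E.op Δ * E.op Δ = E.op Δ := by
  have h := hE Δ Δᶜ hΔ hΔ.compl disjoint_compl_right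
  rw [E.op_compl hΔ, mul_sub, mul_one, sub_eq_zero] at h
  exact h.symm

end POVM

end Bicommutant

/-! ### Order and spectral projections in an isometric copy of `C(Y, ℝ)`. -/

section Representation

variable {H : Type*} [NormedAddCommGroup H] [InnerProductSpace ℂ H]
  {Y : Type*} [TopologicalSpace Y] {ψ : C(Y, ℝ) →ₐ[ℝ] (H →L[ℂ] H)}

/-- The representation of functions on the unit interval obtained by evaluation at `b`. -/
noncomputable def evalRep (ψ : C(Y, ℝ) →ₐ[ℝ] (H →L[ℂ] H)) (b : C(Y, Set.Icc (0 : ℝ) 1)) :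
    C(Set.Icc (0 : ℝ) 1, ℝ) →ₐ[ℝ] (H →L[ℂ] H) :=
  ψ.comp (ContinuousMap.compRightAlgHom ℝ ℝ b)

theorem evalRep_apply (b : C(Y, Set.Icc (0 : ℝ) 1)) (f : C(Set.Icc (0 : ℝ) 1, ℝ)) :
    evalRep ψ b f = ψ (f.comp b) := rfl

variable [CompleteSpace H] [CompactSpace Y]

/-- From `0 ≤ ψ f ≤ ‖f‖` one gets `‖‖f‖ - ψ f‖ ≤ ‖f‖`; by isometry `|‖f‖ - f y| ≤ ‖f‖`, which forces
`f y ≥ 0`. -/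
theorem nonneg_of_isPositive (hn : ∀ f, ‖ψ f‖ = ‖f‖) {f : C(Y, ℝ)} (hf : (ψ f).IsPositive) :
    0 ≤ f := by
  have h1 : ‖ψ (algebraMap ℝ C(Y, ℝ) ‖f‖ - f)‖ ≤ ‖f‖ := by
    refine norm_le_of_inner_eq (q := fun x => ‖f‖ * ‖x‖ ^ 2 - RCLike.re (inner ℂ x (ψ f x)))
      (norm_nonneg f) (fun x => sub_nonneg.2 ?_) (fun x => ?_) (fun x => ?_)
    · calc RCLike.re (inner ℂ x (ψ f x)) ≤ ‖inner ℂ x (ψ f x)‖ := RCLike.re_le_norm _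
        _ ≤ ‖x‖ * ‖ψ f x‖ := norm_inner_le_norm _ _
        _ ≤ ‖x‖ * (‖f‖ * ‖x‖) := by
          gcongr
          exact (ψ f).le_of_opNorm_le (hn f).le x
        _ = _ := by ring
    · exact sub_le_self _ (hf.re_inner_nonneg_right x)
    · have h2 : (algebraMap ℝ (H →L[ℂ] H) ‖f‖) x = (‖f‖ : ℂ) • x := by
        simp [Algebra.algebraMap_eq_smul_one]
      rw [map_sub, AlgHom.commutes, sub_apply, inner_sub_right, h2, inner_smul_right,
        inner_self_eq_norm_sq_to_K, hf.isSelfAdjoint.inner_self_real x]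
      push_cast
      rfl
  rw [hn] at h1
  intro y
  have h2 := (ContinuousMap.norm_coe_le_norm (algebraMap ℝ C(Y, ℝ) ‖f‖ - f) y).trans h1
  have h3 := (abs_le.1 h2).2
  have h4 : (algebraMap ℝ C(Y, ℝ) ‖f‖ - f) y = ‖f‖ - f y := rfl
  rw [h4] at h3
  simpa using h3

/-- The spectral projections of a function, as functions. -/
theorem exists_spectral_projections (hs : ∀ f, IsSelfAdjoint (ψ f)) (hn : ∀ f, ‖ψ f‖ = ‖f‖)
    (hsurj : ∀ B : H →L[ℂ] H, IsSelfAdjoint B →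
      (∀ R, (∀ f, Commute R (ψ f)) → Commute R B) → ∃ f, ψ f = B)
    (b : C(Y, Set.Icc (0 : ℝ) 1)) :
    ∃ p : ℚ → C(Y, ℝ), (∀ r y, p r y = 0 ∨ p r y = 1) ∧
      ∀ r y, (p r y = 1 → (r : ℝ) ≤ b y) ∧ (p r y = 0 → (b y : ℝ) ≤ r) := by
  have hinj : Function.Injective ψ := (injective_iff_map_eq_zero ψ).2 fun f hf => by
    rw [← norm_eq_zero, ← hn, hf, norm_zero]
  obtain ⟨E, hE, hint, hc⟩ := exists_spectralMeasure (φ := evalRep ψ b) (fun f => hs _)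
  let id' : C(Set.Icc (0 : ℝ) 1, ℝ) := ⟨fun t => (t : ℝ), continuous_subtype_val⟩
  have hm : ∀ r : ℚ, MeasurableSet {t : Set.Icc (0 : ℝ) 1 | (r : ℝ) < t} := fun r =>
    measurableSet_lt measurable_const measurable_subtype_coe
  have hex : ∀ r : ℚ, ∃ f, ψ f = E.op {t | (r : ℝ) < t} := fun r =>
    hsurj _ (E.isPositive _ (hm r)).isSelfAdjoint fun R hR => hc _ (hm r) R fun f => hR _
  choose p hp using hex
  have hidem : ∀ r, p r * p r = p r := fun r => hinj (by
    rw [map_mul, hp, hE.op_mul_self (hm r)])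
  have hquad : ∀ (r : ℚ) (c d e : ℝ) (x : H),
      inner ℂ x (ψ (c • id'.comp b + d • p r + e • 1) x) =
        ((∫ t, (c * t + d * Set.indicator {t : Set.Icc (0 : ℝ) 1 | (r : ℝ) < t} 1 t + e)
          ∂(E.scalarMeasure x) : ℝ) : ℂ) := by
    intro r c d e x
    have i1 : Integrable (fun t : Set.Icc (0 : ℝ) 1 => c * (t : ℝ)) (E.scalarMeasure x) :=
      (integrable_continuousMap id').const_mul c
    have i2 : Integrable (fun t => d * Set.indicator {t : Set.Icc (0 : ℝ) 1 | (r : ℝ) < t} 1 t)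
        (E.scalarMeasure x) :=
      ((integrable_const (1 : ℝ)).indicator (hm r)).const_mul d
    have i3 : Integrable (fun t : Set.Icc (0 : ℝ) 1 => e) (E.scalarMeasure x) :=
      integrable_const e
    have i12 : Integrable (fun t : Set.Icc (0 : ℝ) 1 => c * (t : ℝ) +
        d * Set.indicator {t : Set.Icc (0 : ℝ) 1 | (r : ℝ) < t} 1 t) (E.scalarMeasure x) :=
      i1.add i2
    rw [integral_add i12 i3, integral_add i1 i2, integral_const_mul, integral_const_mul,
      integral_indicator_one (hm r), integral_const, E.scalarMeasure_real_univ]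
    have e1 : inner ℂ x (ψ (id'.comp b) x) = ((∫ t, id' t ∂(E.scalarMeasure x) : ℝ) : ℂ) :=
      inner_self_swap_of_real.1 (hint id' x)
    have hsm : ∀ (k : ℝ) (B : H →L[ℂ] H), inner ℂ x ((k • B) x) = (k : ℂ) * inner ℂ x (B x) := by
      intro k B
      have : (k • B) x = (k : ℂ) • B x := by simp
      rw [this, inner_smul_right]
    rw [map_add, map_add, map_smul, map_smul, map_smul, map_one, hp, add_apply, add_apply,
      inner_add_right, inner_add_right, hsm, hsm, hsm, e1, E.inner_op_self x (hm r),
      one_apply_eq_self, inner_self_eq_norm_sq_to_K]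
    push_cast
    rw [smul_eq_mul]
    push_cast
    change _ = _ + _ + (‖x‖ : ℂ) ^ 2 * e
    rw [mul_comm (e : ℂ)]
    rfl
  -- Inequalities between `t` and the indicator of `(r, 1]` on `[0, 1]` pass, through positivity of
  -- operators, to inequalities between `b` and `p r` on `Y`.
  have hpos : ∀ (r : ℚ) (c d e : ℝ),
      (∀ t : Set.Icc (0 : ℝ) 1,
        0 ≤ c * t + d * Set.indicator {t : Set.Icc (0 : ℝ) 1 | (r : ℝ) < t} 1 t + e) →
      ∀ y, 0 ≤ c * b y + d * p r y + e := by
    intro r c d e h y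
    have h1 := nonneg_of_isPositive hn
      (isPositive_of_inner_eq (fun x => integral_nonneg h) (hquad r c d e)) y
    simpa [id'] using h1
  refine ⟨p, fun r y => ?_, fun r y => ⟨fun h => ?_, fun h => ?_⟩⟩
  · have h1 : p r y * p r y = p r y := congrArg (fun f : C(Y, ℝ) => f y) (hidem r)
    rcases eq_or_ne (p r y) 0 with h | h
    · exact Or.inl h
    · exact Or.inr (mul_left_cancel₀ h (h1.trans (mul_one _).symm))
  -- Uses `t - r · 1_{t > r} ≥ 0`, which at `p r y = 1` reads `b y ≥ r`.
  · have := hpos r 1 (-r) 0 (fun t => by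
      by_cases ht : (r : ℝ) < t
      · simp [Set.indicator, ht, ht.le]
      · simpa [Set.indicator, ht] using t.2.1) y
    rw [h] at this
    linarith
  -- Uses `r - t + (1 + |r|) · 1_{t > r} ≥ 0`; the coefficient is large enough because `t ≤ 1`. At
  -- `p r y = 0` it reads `b y ≤ r`.
  · have := hpos r (-1) (1 + |(r : ℝ)|) r (fun t => by
      by_cases ht : (r : ℝ) < t
      · have h1 := t.2.2
        have h2 := neg_abs_le (r : ℝ)
        simp only [Set.indicator, Set.mem_ofPred_eq, ht, if_true, Pi.one_apply]
        linarith
      · simp only [Set.indicator, Set.mem_ofPred_eq, ht, if_false]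
        linarith) y
    rw [h] at this
    linarith

end Representation

/-! ### From continuous functions to a Markov kernel. -/

section Kernel

/-- A `σ`-additive family of continuous functions is a strong Feller Markov kernel. -/
theorem exists_strongFeller_kernel (w : Set ℝ → C(Set.Icc (0 : ℝ) 1, ℝ))
    (hw0 : ∀ Δ, MeasurableSet Δ → 0 ≤ w Δ) (hw1 : w Set.univ = 1)
    (hsum : ∀ Δ : ℕ → Set ℝ, (∀ i, MeasurableSet (Δ i)) → Pairwise (Function.onFun Disjoint Δ) →
      ∀ t, HasSum (fun i => w (Δ i) t) (w (⋃ i, Δ i) t)) :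
    ∃ μ : Kernel (Set.Icc (0 : ℝ) 1) ℝ, IsMarkovKernel μ ∧ IsStrongFeller μ ∧
      ∀ Δ, MeasurableSet Δ → ∀ t, (μ t).real Δ = w Δ t := by
  have hempty : ∀ t, w ∅ t = 0 := fun t => by
    have h := hsum (fun _ => ∅) (fun _ => MeasurableSet.empty)
      (fun _ _ _ => by simp [Function.onFun]) t
    exact tendsto_nhds_unique tendsto_const_nhds h.summable.tendsto_atTop_zero
  let m : Set.Icc (0 : ℝ) 1 → Measure ℝ := fun t =>
    Measure.ofMeasurable (fun Δ _ => ENNReal.ofReal (w Δ t)) (by simp [hempty]) (by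
      intro Δ hΔ hd
      have h := hsum Δ hΔ hd t
      rw [← h.tsum_eq]
      exact ENNReal.ofReal_tsum_of_nonneg (fun i => hw0 _ (hΔ i) t) h.summable)
  have hm : ∀ t Δ, MeasurableSet Δ → m t Δ = ENNReal.ofReal (w Δ t) := fun t Δ hΔ =>
    Measure.ofMeasurable_apply Δ hΔ
  let μ : Kernel (Set.Icc (0 : ℝ) 1) ℝ :=
    { toFun := m
      measurable' := Measure.measurable_of_measurable_coe _ fun Δ hΔ => by
        simp_rw [hm _ Δ hΔ]
        exact (map_continuous (w Δ)).measurable.ennreal_ofReal }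
  have hreal : ∀ Δ, MeasurableSet Δ → ∀ t, (μ t).real Δ = w Δ t := fun Δ hΔ t => by
    rw [measureReal_def, show μ t Δ = m t Δ from rfl, hm t Δ hΔ,
      ENNReal.toReal_ofReal (show 0 ≤ w Δ t from hw0 Δ hΔ t)]
  refine ⟨μ, ⟨fun t => ⟨?_⟩⟩, fun Δ hΔ => ?_, hreal⟩
  · rw [show μ t Set.univ = m t Set.univ from rfl, hm t _ MeasurableSet.univ, hw1]
    simp
  · simp_rw [hreal Δ hΔ]
    exact map_continuous (w Δ)

end Kernel

/-! ### Coding projections into `[0, 1]` and descending along the code. -/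

section Coding

variable {Y : Type*} [TopologicalSpace Y]

/-- A sequence of `{0, 1}`-valued functions is coded by one function into the unit interval. -/
theorem exists_coding (p : ℕ → C(Y, ℝ)) (hp : ∀ k y, p k y = 0 ∨ p k y = 1) :
    ∃ a : C(Y, Set.Icc (0 : ℝ) 1), ∀ y z, a y = a z → ∀ k, p k y = p k z := by
  classical
  -- Ternary expansions without the digit `1` are unique, as for the Cantor set, so the code
  -- determines every `p k y`.
  let d : Y → ℕ → Fin 3 := fun y k => if p k y = 1 then 2 else 0
  have hd1 : ∀ y k, d y k ≠ 1 := fun y k => by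
    simp only [d]
    split_ifs <;> decide
  have hdc : Continuous d := by
    refine continuous_pi fun k => ?_
    refine IsLocallyConstant.continuous ?_
    rw [IsLocallyConstant.iff_eventually_eq]
    intro y
    have h1 : ∀ᶠ z in 𝓝 y, dist (p k z) (p k y) < 1 :=
      (map_continuous (p k)).continuousAt (Metric.ball_mem_nhds _ one_pos)
    filter_upwards [h1] with z hz
    have : p k z = p k y := by
      rcases hp k z with h | h <;> rcases hp k y with h' | h' <;> simp [h, h'] at hz ⊢
    simp only [d, this]
  refine ⟨⟨fun y => ⟨Real.ofDigits (d y), Real.ofDigits_nonneg _, Real.ofDigits_le_one _⟩,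
    (Real.continuous_ofDigits.comp hdc).subtype_mk _⟩, fun y z h k => ?_⟩
  have h1 : Real.ofDigits (d y) = Real.ofDigits (d z) := congrArg Subtype.val h
  have h2 := congrFun (ofDigits_zero_two_sequence_unique (hd1 y) (hd1 z) h1) k
  simp only [d] at h2
  rcases hp k y with h | h <;> rcases hp k z with h' | h' <;> simp [h, h'] at h2 ⊢

/-- Functions constant on the fibres of a map into the unit interval descend to the unit interval,
linearly and positively. -/
theorem exists_linear_descent [CompactSpace Y] [Nonempty Y] (a : C(Y, Set.Icc (0 : ℝ) 1)) :
    ∃ L : C(Y, ℝ) → C(Set.Icc (0 : ℝ) 1, ℝ),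
      (∀ f, (∀ y z, a y = a z → f y = f z) → ∀ y, L f (a y) = f y) ∧ L 1 = 1 ∧
      (∀ f, (∀ y z, a y = a z → f y = f z) → 0 ≤ f → 0 ≤ L f) ∧
      ∀ (n : ℕ) (g : ℕ → C(Y, ℝ)) (f : C(Y, ℝ)), (∀ i y z, a y = a z → g i y = g i z) →
        (∀ y z, a y = a z → f y = f z) →
        ‖∑ i ∈ Finset.range n, L (g i) - L f‖ ≤ ‖∑ i ∈ Finset.range n, g i - f‖ := by
  classical
  have hcpt : IsCompact (Set.range a) := isCompact_range (map_continuous a)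
  have : CompactSpace (Set.range a) := isCompact_iff_compactSpace.1 hcpt
  obtain ⟨T, hT, hT1, hTp, hTn⟩ := exists_linear_extension hcpt.isClosed (Set.range_nonempty a)
  let q : C(Y, Set.range a) := ⟨Set.rangeFactorization a, by fun_prop⟩
  have hq : IsQuotientMap q := IsQuotientMap.of_surjective_continuous
    Set.rangeFactorization_surjective (map_continuous q)
  have hfac : ∀ f : C(Y, ℝ), (∀ y z, a y = a z → f y = f z) → Function.FactorsThrough f q :=
    fun f hf y z h => hf y z (congrArg Subtype.val h)
  -- The descended function is unconstrained when `f` is not constant on fibres. Additivity of `L`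
  -- is thus not available globally, and the norm estimate is stated only for functions that
  -- descend.
  have hex : ∀ f : C(Y, ℝ), ∃ g : C(Set.range a, ℝ), (∀ y z, a y = a z → f y = f z) →
      ∀ y, g (q y) = f y := fun f => by
    by_cases hf : ∀ y z, a y = a z → f y = f z
    · refine ⟨hq.lift f (hfac f hf), fun _ y => ?_⟩
      exact congrArg (fun h : C(Y, ℝ) => h y) (hq.lift_comp f (hfac f hf))
    · exact ⟨0, fun h => absurd h hf⟩
  choose D hD using hex
  have hsurj : ∀ t : Set.range a, ∃ y, q y = t := Set.rangeFactorization_surjective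
  refine ⟨fun f => T (D f), fun f hf y => ?_, ?_, fun f hf h0 => hTp _ fun t => ?_,
    fun n g f hg hf => ?_⟩
  · exact (hT (D f) (q y)).trans (hD f hf y)
  · have : D 1 = 1 := by
      ext t
      obtain ⟨y, rfl⟩ := hsurj t
      exact hD 1 (fun _ _ _ => rfl) y
    change T (D 1) = 1
    rw [this, hT1]
  · obtain ⟨y, rfl⟩ := hsurj t
    exact (h0 y).trans_eq (hD f hf y).symm
  · rw [← map_sum, ← map_sub]
    refine (hTn _).trans ?_
    rw [ContinuousMap.norm_le _ (norm_nonneg _)]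
    intro t
    obtain ⟨y, rfl⟩ := hsurj t
    have h1 := ContinuousMap.norm_coe_le_norm (∑ i ∈ Finset.range n, g i - f) y
    simp only [ContinuousMap.sub_apply, ContinuousMap.sum_apply, fun i => hD (g i) (hg i) y,
      hD f hf y] at h1 ⊢
    exact h1

end Coding

/-! ### Uniform continuity implies a strong Feller kernel. -/

section Converse

universe u

variable {H : Type u} [NormedAddCommGroup H] [InnerProductSpace ℂ H] [CompleteSpace H]

/-- Stone–Weierstrass: whatever commutes with `A` commutes with polynomials in `A`, hence with their
norm limits `f(A)`. -/
theorem commute_evalRep {Y : Type*} [TopologicalSpace Y] [CompactSpace Y]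
    {ψ : C(Y, ℝ) →ₐ[ℝ] (H →L[ℂ] H)} (hn : ∀ f, ‖ψ f‖ = ‖f‖) (a : C(Y, Set.Icc (0 : ℝ) 1))
    {R : H →L[ℂ] H}
    (hR : Commute R (evalRep ψ a ⟨fun t => (t : ℝ), continuous_subtype_val⟩))
    (f : C(Set.Icc (0 : ℝ) 1, ℝ)) : Commute R (evalRep ψ a f) := by
  have hψ : Continuous ψ :=
    (AddMonoidHomClass.isometry_of_norm ψ hn).continuous
  have hcont : Continuous (evalRep ψ a) :=
    hψ.comp (ContinuousMap.compRightAlgHom_continuous ℝ ℝ a)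
  induction f using ContinuousMap.induction_on_of_compact with
  | const r =>
    have : evalRep ψ a (ContinuousMap.const _ r) = algebraMap ℝ _ r :=
      AlgHom.commutes (evalRep ψ a) r
    rw [this]
    exact (Algebra.commutes r R).symm
  | id => exact hR
  | star_id => exact hR
  | add f g hf hg => rw [map_add]; exact hf.add_right hg
  | mul f g hf hg => rw [map_mul]; exact hf.mul_right hg
  | frequently f hf =>
    have hcl : IsClosed {g | Commute R (evalRep ψ a g)} := by
      have : {g | Commute R (evalRep ψ a g)} =
        {g | R * evalRep ψ a g = evalRep ψ a g * R} := rfl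
      rw [this]
      exact isClosed_eq (by fun_prop) (by fun_prop)
    exact hcl.closure_subset (mem_closure_iff_frequently.2 hf)

namespace POVM

/-- On the zero space the Gelfand space is empty and there is no nonempty `a(Y)` to extend from, so
a constant kernel is used. -/
theorem admitsStrongFellerKernel_of_subsingleton [Subsingleton H] (F : POVM ℝ H) :
    F.AdmitsStrongFellerKernel := by
  let E : POVM (Set.Icc (0 : ℝ) 1) H :=
    { op := fun _ => 0
      isPositive := fun _ _ => ContinuousLinearMap.isPositive_zero
      weak_sigma_additive := fun _ _ _ x y => by simp
      normalized := Subsingleton.elim _ _ }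
  have hint : ∀ f B, E.IsIntegral f B := fun f B x => by
    have h0 : x = 0 := Subsingleton.elim _ _
    have hE : E.scalarMeasure x = 0 := by
      ext Δ hΔ
      rw [E.scalarMeasure_apply x hΔ]
      simp [E]
    simp [h0 ▸ hE, h0]
  refine ⟨0, E, Kernel.const _ (Measure.dirac 0), ⟨.zero _, fun _ _ _ _ _ => by simp [E],
    hint _ _, ?_⟩, inferInstance, fun Δ _ => ?_, fun Δ _ => hint _ _⟩
  · refine SetLike.ext fun a => ?_
    have h : a = 0 := Subsingleton.elim _ _
    rw [h]
    exact ⟨fun _ => zero_mem _, fun _ => zero_mem _⟩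
  · simpa using continuous_const

/-- A commutative POVM that is `σ`-additive in the operator norm has a strong Feller kernel. -/
theorem IsUniformlyContinuous.admitsStrongFellerKernel {F : POVM ℝ H}
    (h : F.IsUniformlyContinuous) (hF : F.IsCommutative) : F.AdmitsStrongFellerKernel := by
  cases subsingleton_or_nontrivial H with
  | inl hH => exact F.admitsStrongFellerKernel_of_subsingleton
  | inr hH =>
  have hFsa : ∀ s ∈ {B | ∃ Δ, MeasurableSet Δ ∧ F.op Δ = B}, IsSelfAdjoint s := by
    rintro _ ⟨Δ, hΔ, rfl⟩
    exact (F.isPositive Δ hΔ).isSelfAdjoint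
  obtain ⟨Y, _, _, ψ, hs, hn, hmem, hsurj⟩ :=
    StarSubalgebra.exists_real_gelfand F.vonNeumann.toStarSubalgebra
      (isClosed_vonNeumannGenerated _) (fun a ha b hb =>
        mul_comm_of_mem_vonNeumannGenerated hFsa (by
          rintro _ ⟨Δ, hΔ, rfl⟩ _ ⟨Δ', hΔ', rfl⟩
          exact hF Δ Δ' hΔ hΔ') ha hb)
  have hmem : ∀ f, ψ f ∈ F.vonNeumann := hmem
  have hsurj : ∀ B ∈ F.vonNeumann, IsSelfAdjoint B → ∃ f, ψ f = B := hsurj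
  have hinj : Function.Injective ψ := (injective_iff_map_eq_zero ψ).2 fun f hf => by
    rw [← norm_eq_zero, ← hn, hf, norm_zero]
  have hY : Nonempty Y := by
    by_contra hY
    rw [not_nonempty_iff] at hY
    have h1 : ψ 1 = ψ 0 := congrArg ψ (by ext y; exact hY.elim y)
    rw [map_one, map_zero] at h1
    exact one_ne_zero h1
  have hFmem : ∀ Δ, MeasurableSet Δ → F.op Δ ∈ F.vonNeumann := fun Δ hΔ =>
    F.mem_vonNeumann_iff.2 fun R hR => hR Δ hΔ
  have hex : ∀ Δ, ∃ f, MeasurableSet Δ → ψ f = F.op Δ := fun Δ => by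
    by_cases hΔ : MeasurableSet Δ
    · obtain ⟨f, hf⟩ := hsurj _ (hFmem Δ hΔ) (F.isPositive Δ hΔ).isSelfAdjoint
      exact ⟨f, fun _ => hf⟩
    · exact ⟨0, fun h => absurd h hΔ⟩
  choose k hk using hex
  have hk0 : ∀ Δ, MeasurableSet Δ → 0 ≤ k Δ := fun Δ hΔ =>
    nonneg_of_isPositive hn (by rw [hk Δ hΔ]; exact F.isPositive Δ hΔ)
  have hk1 : ∀ Δ, MeasurableSet Δ → ∀ y, k Δ y ≤ 1 := fun Δ hΔ y =>
    (le_abs_self _).trans ((ContinuousMap.norm_coe_le_norm (k Δ) y).trans (by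
      rw [← hn, hk Δ hΔ]; exact F.norm_op_le_one hΔ))
  have hkcompl : ∀ Δ, MeasurableSet Δ → k Δᶜ = 1 - k Δ := fun Δ hΔ => hinj (by
    rw [hk _ hΔ.compl, map_sub, map_one, hk Δ hΔ, F.op_compl hΔ])
  have hkuniv : k Set.univ = 1 := hinj (by rw [hk _ MeasurableSet.univ, map_one, F.normalized])
  have hkempty : k ∅ = 0 := hinj (by rw [hk _ MeasurableSet.empty, map_zero, F.op_empty])
  have hksum : ∀ Δ : ℕ → Set ℝ, (∀ i, MeasurableSet (Δ i)) →
      Pairwise (Function.onFun Disjoint Δ) →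
      Tendsto (fun n => ‖∑ i ∈ Finset.range n, k (Δ i) - k (⋃ i, Δ i)‖) atTop (𝓝 0) := by
    intro Δ hΔ hd
    have h1 := tendsto_iff_norm_sub_tendsto_zero.1 (h Δ hΔ hd)
    refine h1.congr fun n => ?_
    rw [← hn, map_sub, map_sum, hk _ (MeasurableSet.iUnion hΔ)]
    simp_rw [fun i => hk _ (hΔ i)]
  -- spectral projections of the operators attached to rational half-lines
  have hproj : ∀ q : ℚ, ∃ p : ℚ → C(Y, ℝ), (∀ r y, p r y = 0 ∨ p r y = 1) ∧
      ∀ r y, (p r y = 1 → (r : ℝ) ≤ k (Set.Iic (q : ℝ)) y) ∧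
        (p r y = 0 → k (Set.Iic (q : ℝ)) y ≤ r) := fun q =>
    exists_spectral_projections hs hn (fun B hB hc => hsurj B
      (F.mem_vonNeumann_iff.2 fun R hR => hc R fun f => F.mem_vonNeumann_iff.1 (hmem f) R hR) hB)
      ⟨fun y => ⟨k (Set.Iic (q : ℝ)) y, hk0 _ measurableSet_Iic y, hk1 _ measurableSet_Iic y⟩,
        (map_continuous (k (Set.Iic (q : ℝ)))).subtype_mk _⟩
  choose p hp01 hp using hproj
  obtain ⟨a, ha⟩ := exists_coding
    (fun n => p ((Denumerable.eqv (ℚ × ℚ)).symm n).1 ((Denumerable.eqv (ℚ × ℚ)).symm n).2)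
    (fun n y => hp01 _ _ y)
  have hpa : ∀ y z, a y = a z → ∀ q r, p q r y = p q r z := fun y z hyz q r => by
    simpa using ha y z hyz (Denumerable.eqv (ℚ × ℚ) (q, r))
  have hle : ∀ y z, a y = a z → ∀ q : ℚ, k (Set.Iic (q : ℝ)) y ≤ k (Set.Iic (q : ℝ)) z := by
    intro y z hyz q
    by_contra! hlt
    obtain ⟨r, hr1, hr2⟩ := exists_rat_btwn hlt
    rcases hp01 q r y with h0 | h1
    · exact absurd ((hp q r y).2 h0) (not_le.2 hr2)
    · rw [hpa y z hyz] at h1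
      exact absurd ((hp q r z).1 h1) (not_le.2 hr1)
  -- The union step needs convergence at every single point of `Y`, which is what norm additivity of
  -- `F` supplies.
  have hka : ∀ Δ, MeasurableSet Δ → ∀ y z, a y = a z → k Δ y = k Δ z := by
    intro Δ hΔ
    induction Δ, hΔ using MeasurableSpace.induction_on_inter
      (BorelSpace.measurable_eq.trans Real.borel_eq_generateFrom_Iic_rat)
      Real.isPiSystem_Iic_rat with
    | empty => intro y z _; rw [hkempty]; rfl
    | basic t ht =>
      intro y z hyz
      obtain ⟨q, rfl⟩ := Set.mem_iUnion.1 ht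
      exact le_antisymm (hle y z hyz q) (hle z y hyz.symm q)
    | compl t ht ih =>
      intro y z hyz
      rw [hkcompl t ht, ContinuousMap.sub_apply, ContinuousMap.sub_apply, ih y z hyz]
      rfl
    | iUnion f hd hf ih =>
      intro y z hyz
      have hev : ∀ v : Y, Tendsto (fun n => ∑ i ∈ Finset.range n, k (f i) v) atTop
          (𝓝 (k (⋃ i, f i) v)) := fun v => by
        rw [tendsto_iff_norm_sub_tendsto_zero]
        refine squeeze_zero (fun _ => norm_nonneg _) (fun n => ?_) (hksum f hf hd)
        have := ContinuousMap.norm_coe_le_norm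
          (∑ i ∈ Finset.range n, k (f i) - k (⋃ i, f i)) v
        simpa [ContinuousMap.sum_apply] using this
      refine tendsto_nhds_unique (hev y) ((hev z).congr fun n => ?_)
      exact Finset.sum_congr rfl fun i _ => (ih i y z hyz).symm
  obtain ⟨L, hL, hL1, hL0, hLn⟩ := exists_linear_descent a
  obtain ⟨μ, hμM, hμF, hμ⟩ := exists_strongFeller_kernel (fun Δ => L (k Δ))
    (fun Δ hΔ => hL0 _ (hka Δ hΔ) (hk0 Δ hΔ)) (by rw [hkuniv, hL1]) (by
      intro Δ hΔ hd t
      have hnonneg : ∀ i, 0 ≤ L (k (Δ i)) t := fun i => hL0 _ (hka _ (hΔ i)) (hk0 _ (hΔ i)) t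
      rw [hasSum_iff_tendsto_nat_of_nonneg hnonneg, tendsto_iff_norm_sub_tendsto_zero]
      refine squeeze_zero (fun _ => norm_nonneg _) (fun n => ?_) (hksum Δ hΔ hd)
      refine le_trans ?_ (hLn n _ _ (fun i => hka _ (hΔ i)) (hka _ (MeasurableSet.iUnion hΔ)))
      have := ContinuousMap.norm_coe_le_norm
        (∑ i ∈ Finset.range n, L (k (Δ i)) - L (k (⋃ i, Δ i))) t
      simpa [ContinuousMap.sum_apply] using this)
  obtain ⟨E, hE, hint, -⟩ := exists_spectralMeasure (φ := evalRep ψ a) (fun f => hs _)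
  -- Values of `L (k Δ)` off the range of `a` are irrelevant here: only the composite with `a`
  -- enters.
  have hFrep : ∀ Δ, MeasurableSet Δ → evalRep ψ a (L (k Δ)) = F.op Δ := fun Δ hΔ => by
    rw [evalRep_apply, ← hk Δ hΔ]
    congr 1
    ext y
    exact hL _ (hka Δ hΔ) y
  let id' : C(Set.Icc (0 : ℝ) 1, ℝ) := ⟨fun t => (t : ℝ), continuous_subtype_val⟩
  refine ⟨evalRep ψ a id', E, μ, ⟨hs _, hE, hint id', le_antisymm ?_ ?_⟩, hμM, hμF,
    fun Δ hΔ => ?_⟩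
  · rw [vonNeumannGenerated_le_iff, Set.singleton_subset_iff]
    exact hmem _
  · rw [vonNeumann, vonNeumannGenerated_le_iff]
    rintro _ ⟨Δ, hΔ, rfl⟩
    refine (mem_vonNeumannGenerated_iff ?_).2 fun R hR => ?_
    · rintro _ rfl
      exact hs _
    · rw [← hFrep Δ hΔ]
      exact commute_evalRep hn a (hR _ rfl) _
  · simp_rw [hμ Δ hΔ]
    rw [← hFrep Δ hΔ]
    exact hint _

end POVM

end Converse

theorem theorem5p5 {H : Type*} [NormedAddCommGroup H] [InnerProductSpace ℂ H] [CompleteSpace H]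
    (F : POVM ℝ H) (hF : F.IsCommutative) :
    F.AdmitsStrongFellerKernel ↔ F.IsUniformlyContinuous :=
  ⟨fun h => h.isUniformlyContinuous, fun h => h.admitsStrongFellerKernel hF⟩
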